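/- All graphs are finite and simple. A \emph{list-assignment} $L$ for a graph $G$ gives each vertex $v$ a non-empty set $L(v)$ of colors; it is a \emph{$k$-list-assignment} if $|L(v)|\ge k$ for every $v\in V(G)$. The graph $G$ is \emph{$L$-colorable} if there is a map $\phi$ on $V(G)$ with $\phi(v)\in L(v)$ for every $v\in V(G)$ and $\phi(u)\ne\phi(v)$ for every edge $uv$; it is \emph{$L$-critical} if $G$ is not $L$-colorable but every proper induced subgraph of $G$ is (with the restricted lists). Let $\omega(G)$ be the size of a largest clique in $G$ and $\mathrm{ad}(G)=\frac{1}{|V(G)|}\sum_{v\in V(G)}d(v)$ its average degree. Theorem. For every $\alpha>0$ and every real $\varepsilon\le\frac{\alpha^2}{1350}$ there is an integer $k_0$ such that for every integer $k\ge k_0$ the following holds. If $G$ is an $L$-critical graph for some $k$-list-assignment $L$ and $\omega(G)<\left(\frac12-\alpha\right)k$, then \[ \mathrm{ad}(G)>(1+\varepsilon)k. \] -/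

import Mathlib

namespace SimpleGraph

/-- `G` is `L`-colorable: there is a proper coloring of `G` in which every vertex `v` receives
a color from its own list `L v`. -/
def IsListColorable {V : Type*} {C : Type*} (G : SimpleGraph V) (L : V → Set C) : Prop :=
  ∃ φ : G.Coloring C, ∀ v, φ v ∈ L v

/-- `L` is a `k`-list-assignment for a graph with vertex set `V`: every list is non-empty and has
at least `k` colors. -/
def IsListAssignment {V : Type*} {C : Type*} (k : ℕ) (L : V → Set C) : Prop :=
  ∀ v, (L v).Nonempty ∧ (k : ℕ∞) ≤ (L v).encard

/-- `G` is `L`-critical: `G` is not `L`-colorable, but every proper induced subgraph of `G` is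
(with the lists restricted to its vertices). -/
def IsListCritical {V : Type*} {C : Type*} (G : SimpleGraph V) (L : V → Set C) : Prop :=
  ¬ G.IsListColorable L ∧
    ∀ s : Set V, s ≠ Set.univ → (G.induce s).IsListColorable (fun v : s => L v)

/-- The average degree of a finite graph. -/
noncomputable def avgDegree {V : Type*} [Fintype V] (G : SimpleGraph V) [DecidableRel G.Adj] : ℝ :=
  (∑ v, (G.degree v : ℝ)) / Fintype.card V

end SimpleGraph

/-! Suppose the average degree is at most (1 + α²/1350)k. Let s(v) = d(v) − k be the excess, which
criticality makes nonnegative, and let Om = (1/2 − α)k be the clique bound. The total excess is so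
small that edge counting gives an induced subgraph H in which every degree is at least Om + αk/100 +
2600 s(v). For every nonempty X inside H, coloring the rest of G by criticality leaves lists on X,
of size at least deg_X − s, from which X cannot be colored. `not_critical_of_nearly_degree_lists`
refutes this.

Random coloring: every vertex picks a uniform color from a list of size d_H − s and is active with
probability 1/2. An active vertex keeps its color unless a neighbor with a list at least as long
actively picks the same one. The other vertices are colored greedily, longest lists first. This
succeeds once each v saves more than s(v) colors, through inactive neighbors with shorter lists,
colors kept outside L(v), and colors kept twice (`ListColorableOn.of_gain`). The savings are local
and concentrated, so by the local lemma it is enough that their expectation exceeds s(v) by a margin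
linear in k (`exists_gain`).

Expectation: let g = d_H(v) − Om. If the expected savings at v are below g/2500, then by
`le_expect_gain`, after discarding at most 0.21g neighbors, the neighborhood has lists close to L(v)
and few non-edges. As its cliques have at most Om vertices, it contains many disjoint nonadjacent
pairs; giving each pair one common color saves enough to color this part from the lists left by
criticality (`ListColorableOn.of_dense`), a contradiction. So the expected savings are at least
g/2500, which beats s(v) because of the term 2600 s(v). -/

section

open Finset
open scoped BigOperators

/-! ### Independence, concentration and the local lemma on finite product spaces. -/

section ProductSpace

variable {ι : Type*} [Fintype ι] [DecidableEq ι] {α : ι → Type*} [∀ i, Fintype (α i)]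

/-- Resampling one coordinate does not change the average over a product space. -/
theorem expect_update [∀ i, Nonempty (α i)] (i : ι) (F : (∀ i, α i) → ℝ) :
    𝔼 t : α i, 𝔼 ω : ∀ i, α i, F (Function.update ω i t) = 𝔼 ω, F ω := by
  rw [← Fintype.expect_const (ι := α i) (𝔼 ω, F ω), ← expect_product', ← expect_product',
    univ_product_univ]
  refine Fintype.expect_equiv
    ⟨fun x => (x.2 i, Function.update x.2 i x.1), fun x => (x.2 i, Function.update x.2 i x.1),
      fun x => by simp, fun x => by simp⟩ _ _ fun x => by simp

/-- Merging two independent copies along a set of coordinates gives a uniform sample. -/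
theorem expect_piecewise [∀ i, Nonempty (α i)] (s : Finset ι) (F : (∀ i, α i) → ℝ) :
    𝔼 ω : ∀ i, α i, 𝔼 ω' : ∀ i, α i, F (s.piecewise ω ω') = 𝔼 ω, F ω := by
  rw [← Fintype.expect_const (ι := ∀ i, α i) (𝔼 ω, F ω), expect_comm, ← expect_product',
    ← expect_product', univ_product_univ]
  have hinv : ∀ x : (∀ i, α i) × (∀ i, α i),
      (s.piecewise (s.piecewise x.1 x.2) (s.piecewise x.2 x.1),
        s.piecewise (s.piecewise x.2 x.1) (s.piecewise x.1 x.2)) = x := by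
    intro x
    ext i <;> by_cases h : i ∈ s <;> simp [h]
  let swap : (∀ i, α i) × (∀ i, α i) → (∀ i, α i) × (∀ i, α i) :=
    fun x => (s.piecewise x.1 x.2, s.piecewise x.2 x.1)
  exact Fintype.expect_equiv ⟨swap, swap, hinv, hinv⟩ _ _ fun x => rfl

/-- Functions of disjoint sets of coordinates are independent. -/
theorem expect_mul_of_disjoint [∀ i, Nonempty (α i)] (s : Finset ι) (F G : (∀ i, α i) → ℝ)
    (hF : ∀ ω ω', (∀ i ∈ s, ω i = ω' i) → F ω = F ω')
    (hG : ∀ ω ω', (∀ i ∉ s, ω i = ω' i) → G ω = G ω') :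
    𝔼 ω, F ω * G ω = (𝔼 ω, F ω) * 𝔼 ω, G ω := by
  rw [← expect_piecewise s, expect_mul_expect]
  refine expect_congr rfl fun ω _ => expect_congr rfl fun ω' _ => ?_
  rw [hF (s.piecewise ω ω') ω fun i hi => by simp [hi],
    hG (s.piecewise ω ω') ω' fun i hi => by simp [hi]]

/-- The probability of a box. -/
theorem expect_box (B : ∀ i, Finset (α i)) [∀ i, DecidableEq (α i)] :
    𝔼 ω : ∀ i, α i, (if ∀ i, ω i ∈ B i then (1 : ℝ) else 0) =
      ∏ i, ((B i).card / Fintype.card (α i) : ℝ) := by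
  rw [Fintype.expect_eq_sum_div_card, Finset.sum_boole, Fintype.card_pi, Finset.prod_div_distrib]
  congr 1
  · rw [← Nat.cast_prod, ← Fintype.card_piFinset]
    congr 2
    ext ω
    simp [Fintype.mem_piFinset]
  · push_cast; rfl

/-- One-variable exponential moment bound for a function that is constant off a set of density
at most `p`. -/
theorem expect_exp_le_one_variable {β : Type*} [Fintype β] [Nonempty β] (h : β → ℝ)
    (R : Set β) [DecidablePred (· ∈ R)] {c p l : ℝ} (hl : 0 ≤ l) (hlc : 2 * l * c ≤ 1)
    (h1 : ∀ t t', |h t - h t'| ≤ c) (h2 : ∀ t t', t ∉ R → t' ∉ R → h t = h t')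
    (hp : 𝔼 t, (if t ∈ R then (1 : ℝ) else 0) ≤ p) :
    𝔼 t, Real.exp (-l * h t) ≤ Real.exp (-l * (𝔼 t, h t) + l ^ 2 * c ^ 2 * p) := by
  -- Centering at the common value `b` off `R`, not at the mean, makes the second moment live on
  -- `R`; passing to the mean only decreases it.
  obtain ⟨b, hb, hbR⟩ : ∃ b, (∀ t, |h t - b| ≤ c) ∧ ∀ t ∉ R, h t = b := by
    by_cases hR : ∃ t, t ∉ R
    · obtain ⟨t0, ht0⟩ := hR
      exact ⟨h t0, fun t => h1 _ _, fun t ht => h2 _ _ ht ht0⟩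
    · push Not at hR
      obtain ⟨t0⟩ := ‹Nonempty β›
      exact ⟨h t0, fun t => h1 _ _, fun t ht => absurd (hR t) ht⟩
  set y : β → ℝ := fun t => h t - b with hy
  set e : ℝ := 𝔼 t, y t with he
  have hEh : 𝔼 t, h t = e + b := by
    rw [he, hy, expect_sub_distrib, Fintype.expect_const]; ring
  have hec : |e| ≤ c := by
    refine (abs_expect_le _ _).trans ?_
    refine (expect_le_expect (g := fun _ => c) fun t _ => hb t).trans ?_
    rw [Fintype.expect_const]
  have hy2 : ∀ t, y t ^ 2 ≤ c ^ 2 * (if t ∈ R then 1 else 0) := by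
    intro t
    split_ifs with ht
    · rw [mul_one]; exact sq_le_sq' (by linarith [(abs_le.1 (hb t)).1]) (abs_le.1 (hb t)).2
    · simp [hy, hbR t ht]
  -- This is exp(z) ≤ 1 + z + z² for |z| ≤ 1. The deviation from the mean is at most 2c, which is
  -- where `hlc` comes from.
  have key : ∀ t, Real.exp (-l * (y t - e)) ≤ 1 - l * (y t - e) + l ^ 2 * (y t - e) ^ 2 := by
    intro t
    have hz : |-l * (y t - e)| ≤ 1 := by
      rw [abs_mul, abs_neg, abs_of_nonneg hl]
      have : |y t - e| ≤ 2 * c := (abs_sub _ _).trans (by linarith [hb t])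
      nlinarith
    have := (abs_le.1 (Real.abs_exp_sub_one_sub_id_le hz)).2
    nlinarith
  have hmain : 𝔼 t, Real.exp (-l * (y t - e)) ≤ 1 + l ^ 2 * c ^ 2 * p := by
    calc 𝔼 t, Real.exp (-l * (y t - e))
        ≤ 𝔼 t, (1 - l * (y t - e) + l ^ 2 * (y t - e) ^ 2) := expect_le_expect fun t _ => key t
      _ = 1 - l ^ 2 * e ^ 2 + l ^ 2 * 𝔼 t, y t ^ 2 := by
          have : ∀ t, 1 - l * (y t - e) + l ^ 2 * (y t - e) ^ 2 =
              (1 + l * e + l ^ 2 * e ^ 2) + ((-l - 2 * l ^ 2 * e) * y t + l ^ 2 * y t ^ 2) := by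
            intro t; ring
          simp_rw [this]
          rw [expect_add_distrib, Fintype.expect_const, expect_add_distrib, ← mul_expect,
            ← mul_expect, ← he]
          ring
      _ ≤ 1 + l ^ 2 * 𝔼 t, y t ^ 2 := by nlinarith [mul_nonneg (sq_nonneg l) (sq_nonneg e)]
      _ ≤ 1 + l ^ 2 * (c ^ 2 * p) := by
          gcongr
          calc 𝔼 t, y t ^ 2 ≤ 𝔼 t, c ^ 2 * (if t ∈ R then (1 : ℝ) else 0) :=
                expect_le_expect fun t _ => hy2 t
            _ = c ^ 2 * 𝔼 t, (if t ∈ R then (1 : ℝ) else 0) := by rw [mul_expect]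
            _ ≤ c ^ 2 * p := by gcongr
      _ = _ := by ring
  calc 𝔼 t, Real.exp (-l * h t)
      = Real.exp (-l * (e + b)) * 𝔼 t, Real.exp (-l * (y t - e)) := by
        rw [mul_expect]
        refine expect_congr rfl fun t _ => ?_
        rw [← Real.exp_add, hy]
        congr 1
        ring
    _ ≤ Real.exp (-l * (e + b)) * Real.exp (l ^ 2 * c ^ 2 * p) := by
        gcongr
        exact hmain.trans (by linarith [Real.add_one_le_exp (l ^ 2 * c ^ 2 * p)])
    _ = _ := by rw [← Real.exp_add, hEh]

/-- Exponential moment bound for a `c`-Lipschitz function on a product space whose `i`-th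
coordinate matters only if it lies in a set of density at most `p i`. -/
theorem expect_exp_le [∀ i, Nonempty (α i)] (F : (∀ i, α i) → ℝ) (R : ∀ i, Set (α i))
    [∀ i, DecidablePred (· ∈ R i)] {c l : ℝ} (p : ι → ℝ) (hl : 0 ≤ l)
    (hlc : 2 * l * c ≤ 1)
    (h1 : ∀ ω i t, |F (Function.update ω i t) - F ω| ≤ c)
    (h2 : ∀ ω i t, ω i ∉ R i → t ∉ R i → F (Function.update ω i t) = F ω)
    (hp : ∀ i, 𝔼 t, (if t ∈ R i then (1 : ℝ) else 0) ≤ p i) :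
    𝔼 ω, Real.exp (-l * F ω) ≤ Real.exp (-l * (𝔼 ω, F ω) + l ^ 2 * c ^ 2 * ∑ i, p i) := by
  -- Martingale argument: the coordinates in `s` are averaged, the others frozen at `ω`. Adding `i`
  -- to `s` applies the one-variable bound to the partial average `h`, which inherits the Lipschitz
  -- constant and the set `R i`.
  have main : ∀ s : Finset ι, ∀ ω : ∀ i, α i,
      𝔼 ω' : ∀ i, α i, Real.exp (-l * F (s.piecewise ω' ω)) ≤
        Real.exp (-l * (𝔼 ω' : ∀ i, α i, F (s.piecewise ω' ω)) + l ^ 2 * c ^ 2 * ∑ i ∈ s, p i) := by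
    intro s
    induction s using Finset.induction_on with
    | empty => intro ω; simp
    | insert i s his ih =>
      intro ω
      have hpw : ∀ (ω' : ∀ i, α i) (t : α i),
          (insert i s).piecewise (Function.update ω' i t) ω =
            s.piecewise ω' (Function.update ω i t) := by
        intro ω' t
        ext j
        by_cases hj : j = i
        · subst hj; simp [his]
        · by_cases hjs : j ∈ s <;> simp [hj, hjs]
      have split : ∀ Ψ : (∀ i, α i) → ℝ, 𝔼 ω' : ∀ i, α i, Ψ ((insert i s).piecewise ω' ω) =
          𝔼 t : α i, 𝔼 ω' : ∀ i, α i, Ψ (s.piecewise ω' (Function.update ω i t)) := by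
        intro Ψ
        rw [← expect_update i]
        simp_rw [hpw]
      set h : α i → ℝ := fun t => 𝔼 ω' : ∀ i, α i, F (s.piecewise ω' (Function.update ω i t))
        with hh
      have hswap : ∀ (ω' : ∀ i, α i) (t : α i), s.piecewise ω' (Function.update ω i t) =
          Function.update (s.piecewise ω' ω) i t := by
        intro ω' t
        ext j
        by_cases hj : j = i
        · subst hj; simp [his]
        · by_cases hjs : j ∈ s <;> simp [hj, hjs]
      have hF1 : ∀ (ω : ∀ i, α i) t t', |F (Function.update ω i t) - F (Function.update ω i t')| ≤ c := by
        intro ω t t'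
        simpa using h1 (Function.update ω i t') i t
      have hF2 : ∀ (ω : ∀ i, α i) t t', t ∉ R i → t' ∉ R i →
          F (Function.update ω i t) = F (Function.update ω i t') := by
        intro ω t t' ht ht'
        simpa using h2 (Function.update ω i t') i t (by simpa using ht') ht
      have hone := expect_exp_le_one_variable h (R i) hl hlc
        (by
          intro t t'
          rw [hh]
          simp only
          rw [← expect_sub_distrib]
          refine (abs_expect_le _ _).trans ?_
          refine (expect_le_expect (g := fun _ => c) fun ω' _ => ?_).trans
            (by rw [Fintype.expect_const])
          rw [hswap, hswap]
          exact hF1 _ _ _)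
        (by
          intro t t' ht ht'
          refine expect_congr rfl fun ω' _ => ?_
          rw [hswap, hswap]
          exact hF2 _ _ _ ht ht') (hp i)
      rw [split F, split fun ω => Real.exp (-l * F ω), sum_insert his]
      calc 𝔼 t : α i, 𝔼 ω' : ∀ i, α i, Real.exp (-l * F (s.piecewise ω' (Function.update ω i t)))
          ≤ 𝔼 t : α i, Real.exp (-l * h t) * Real.exp (l ^ 2 * c ^ 2 * ∑ i ∈ s, p i) := by
            refine expect_le_expect fun t _ => ?_
            rw [← Real.exp_add]
            exact ih _
        _ = (𝔼 t : α i, Real.exp (-l * h t)) * Real.exp (l ^ 2 * c ^ 2 * ∑ i ∈ s, p i) := by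
            rw [expect_mul]
        _ ≤ Real.exp (-l * (𝔼 t, h t) + l ^ 2 * c ^ 2 * p i) *
              Real.exp (l ^ 2 * c ^ 2 * ∑ i ∈ s, p i) := by gcongr
        _ = _ := by rw [← Real.exp_add]; congr 1; ring
  obtain ⟨ω0⟩ : Nonempty (∀ i, α i) := inferInstance
  simpa using main univ ω0

/-- The symmetric Lovász local lemma on a finite product space with uniform measure. -/
theorem exists_avoiding [∀ i, Nonempty (α i)] {J : Type*} [Fintype J] [DecidableEq J]
    (A : J → (∀ i, α i) → Prop) [∀ v, DecidablePred (A v)] (S : J → Finset ι)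
    (hS : ∀ v ω ω', (∀ i ∈ S v, ω i = ω' i) → (A v ω ↔ A v ω')) {p : ℝ} (D : ℕ)
    (hp : ∀ v, 𝔼 ω, (if A v ω then (1 : ℝ) else 0) ≤ p)
    (hD : ∀ v, (univ.filter fun w => ¬ Disjoint (S v) (S w)).card ≤ D)
    (hpD : 4 * p * D ≤ 1) (hp2 : 4 * p ≤ 1) : ∃ ω, ∀ v, ¬ A v ω := by
  classical
  set a : J → (∀ i, α i) → ℝ := fun v ω => if A v ω then 1 else 0 with ha
  set g : Finset J → (∀ i, α i) → ℝ := fun B ω => if ∀ w ∈ B, ¬ A w ω then 1 else 0 with hg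
  have ha0 : ∀ v ω, 0 ≤ a v ω := fun v ω => by rw [ha]; positivity
  have hg0 : ∀ B ω, 0 ≤ g B ω := fun v ω => by rw [hg]; positivity
  have hgE : ∀ B, 0 ≤ 𝔼 ω, g B ω := fun B => expect_nonneg fun ω _ => hg0 B ω
  -- In conditional form: given that no event of `B` occurs, `A v` has probability at most 2p.
  have step : ∀ n : ℕ, ∀ B : Finset J, B.card = n → ∀ v,
      𝔼 ω, a v ω * g B ω ≤ 2 * p * 𝔼 ω, g B ω := by
    intro n
    induction n using Nat.strong_induction_on with
    | _ n ih =>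
    intro B hB v
    have hp0 : 0 ≤ p := (expect_nonneg fun ω _ => ha0 v ω).trans (hp v)
    set B1 := B.filter fun w => ¬ Disjoint (S v) (S w) with hB1
    set B2 := B.filter fun w => Disjoint (S v) (S w) with hB2
    have hind : 𝔼 ω, a v ω * g B2 ω = (𝔼 ω, a v ω) * 𝔼 ω, g B2 ω := by
      refine expect_mul_of_disjoint (S v) _ _ (fun ω ω' h => ?_) (fun ω ω' h => ?_)
      · simp only [ha, hS v ω ω' h]
      · have : (∀ w ∈ B2, ¬ A w ω) ↔ ∀ w ∈ B2, ¬ A w ω' := by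
          refine forall₂_congr fun w hw => not_congr (hS w ω ω' fun i hi => h i ?_)
          exact fun hi' => Finset.disjoint_left.1 (mem_filter.1 hw).2 hi' hi
        simp only [hg, this]
    have hle : 𝔼 ω, a v ω * g B ω ≤ p * 𝔼 ω, g B2 ω := by
      calc 𝔼 ω, a v ω * g B ω ≤ 𝔼 ω, a v ω * g B2 ω := by
            refine expect_le_expect fun ω _ => mul_le_mul_of_nonneg_left ?_ (ha0 v ω)
            simp only [hg]
            split_ifs with h1 h2 <;> norm_num
            exact absurd (fun w hw => h1 w (mem_filter.1 hw).1) h2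
        _ ≤ p * 𝔼 ω, g B2 ω := by
            rw [hind]
            exact mul_le_mul_of_nonneg_right (hp v) (hgE _)
    -- At most `D` events share a coordinate with `A v`. By induction each has conditional
    -- probability at most 2p given `B2`, so together they remove at most 2pD ≤ 1/2 of the mass.
    have hhalf : 𝔼 ω, g B2 ω ≤ 2 * 𝔼 ω, g B ω := by
      by_cases hne : B1 = ∅
      · have : B2 = B := by
          refine filter_true_of_mem fun w hw => ?_
          by_contra hcon
          exact Finset.notMem_empty w (hne ▸ mem_filter.2 ⟨hw, hcon⟩)
        rw [this]; linarith [hgE B]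
      · have hcard : B2.card < n := by
          rw [← hB]
          have h2 : B2.card + B1.card = B.card :=
            card_filter_add_card_filter_not (s := B) fun w => Disjoint (S v) (S w)
          have h3 : 0 < B1.card := card_pos.2 (nonempty_iff_ne_empty.2 hne)
          omega
        have hpt : ∀ ω, g B2 ω ≤ g B ω + ∑ w ∈ B1, a w ω * g B2 ω := by
          intro ω
          by_cases h2 : ∀ w ∈ B2, ¬ A w ω
          · by_cases hb : ∀ w ∈ B, ¬ A w ω
            · have : 0 ≤ ∑ w ∈ B1, a w ω * g B2 ω :=
                sum_nonneg fun w _ => mul_nonneg (ha0 _ _) (hg0 _ _)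
              have h5 : g B2 ω = 1 := if_pos h2
              have h6 : g B ω = 1 := if_pos hb
              linarith
            · push Not at hb
              obtain ⟨w, hw, hAw⟩ := hb
              have hw1 : w ∈ B1 := by
                refine mem_filter.2 ⟨hw, fun hd => h2 w (mem_filter.2 ⟨hw, hd⟩) hAw⟩
              have h7 : a w ω * g B2 ω ≤ ∑ w ∈ B1, a w ω * g B2 ω :=
                single_le_sum (f := fun w => a w ω * g B2 ω)
                  (fun w _ => mul_nonneg (ha0 _ _) (hg0 _ _)) hw1
              have h8 : a w ω = 1 := if_pos hAw
              rw [h8, one_mul] at h7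
              linarith [hg0 B ω]
          · have h5 : g B2 ω = 0 := if_neg h2
            rw [h5]
            exact add_nonneg (hg0 _ _) (sum_nonneg fun w _ => by simp)
        have h9 : 𝔼 ω, g B2 ω ≤ 𝔼 ω, g B ω + ∑ w ∈ B1, 𝔼 ω, a w ω * g B2 ω := by
          rw [← expect_sum_comm, ← expect_add_distrib]
          exact expect_le_expect fun ω _ => hpt ω
        have h10 : ∑ w ∈ B1, 𝔼 ω, a w ω * g B2 ω ≤ D * (2 * p * 𝔼 ω, g B2 ω) := by
          calc _ ≤ ∑ w ∈ B1, 2 * p * 𝔼 ω, g B2 ω := sum_le_sum fun w _ => ih _ hcard _ rfl w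
            _ = B1.card * (2 * p * 𝔼 ω, g B2 ω) := by rw [sum_const, nsmul_eq_mul]
            _ ≤ _ := by
              have : 0 ≤ 2 * p * 𝔼 ω, g B2 ω := by have := hgE B2; positivity
              gcongr
              exact (card_le_card (filter_subset_filter _ (subset_univ _))).trans (hD v)
        nlinarith [hgE B2]
    nlinarith [hgE B]
  have pos : ∀ B : Finset J, 0 < 𝔼 ω, g B ω := by
    intro B
    induction B using Finset.induction_on with
    | empty => simp [hg]
    | insert w B hw ih =>
      have hpt : ∀ ω, g (insert w B) ω = g B ω - a w ω * g B ω := by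
        intro ω
        by_cases h1 : A w ω <;> by_cases h2 : ∀ w ∈ B, ¬ A w ω <;> simp [hg, ha, h1, h2]
      simp_rw [hpt]
      rw [expect_sub_distrib]
      have := step _ B rfl w
      nlinarith
  by_contra hcon
  push Not at hcon
  have := pos univ
  have hz : ∀ ω, g univ ω = 0 := fun ω => if_neg (by
    obtain ⟨v, hv⟩ := hcon ω
    exact fun h => h v (mem_univ v) hv)
  simp [hz] at this

end ProductSpace

/-! ### Deterministic list coloring: greedy extension, small pots, dense graphs. -/

namespace SimpleGraph

variable {U C : Type*} [DecidableEq U] [DecidableEq C]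

/-- The subgraph induced by `X` can be properly colored from the lists `L`. -/
def ListColorableOn (H : SimpleGraph U) (X : Finset U) (L : U → Finset C) : Prop :=
  ∃ φ : U → C, (∀ v ∈ X, φ v ∈ L v) ∧ ∀ v ∈ X, ∀ w ∈ X, H.Adj v w → φ v ≠ φ w

/-- Greedy extension of a proper partial coloring, in decreasing order of `ρ`. -/
theorem ListColorableOn.of_greedy (H : SimpleGraph U) [DecidableRel H.Adj] (X : Finset U)
    (L : U → Finset C) (ρ : U → ℕ) (P : Finset U) (φ : U → C) (hPX : P ⊆ X)
    (hL : ∀ v ∈ P, φ v ∈ L v) (hφ : ∀ v ∈ P, ∀ w ∈ P, H.Adj v w → φ v ≠ φ w)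
    (h : ∀ v ∈ X \ P, (((P.filter (H.Adj v)).image φ) ∩ L v).card +
      ((X \ P).filter fun u => H.Adj v u ∧ ρ v ≤ ρ u).card < (L v).card) :
    H.ListColorableOn X L := by
  induction hn : (X \ P).card generalizing P φ with
  | zero =>
    have hXP : X ⊆ P := sdiff_eq_empty_iff_subset.1 (card_eq_zero.1 hn)
    exact ⟨φ, fun v hv => hL v (hXP hv), fun v hv w hw => hφ v (hXP hv) w (hXP hw)⟩
  | succ n ih =>
    have hne : (X \ P).Nonempty := card_pos.1 (by omega)
    obtain ⟨v, hv, hmax⟩ := exists_max_image (X \ P) ρ hne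
    have hvX := (mem_sdiff.1 hv).1
    have hvP := (mem_sdiff.1 hv).2
    obtain ⟨c, hcL, hc⟩ : ∃ c ∈ L v, c ∉ (P.filter (H.Adj v)).image φ := by
      by_contra! hcon
      have : ((P.filter (H.Adj v)).image φ) ∩ L v = L v := inter_eq_right.2 hcon
      have h1 := h v hv
      rw [this] at h1
      omega
    have hne' : ∀ w ∈ P, w ≠ v := fun w hw e => hvP (e ▸ hw)
    refine ih (insert v P) (Function.update φ v c) (insert_subset hvX hPX) ?_ ?_ ?_ ?_
    · intro w hw
      rcases mem_insert.1 hw with rfl | hw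
      · simpa using hcL
      · simpa [hne' w hw] using hL w hw
    · have hcw : ∀ w ∈ P, H.Adj v w → φ w ≠ c := fun w hw hvw e =>
        hc (mem_image.2 ⟨w, mem_filter.2 ⟨hw, hvw⟩, e⟩)
      intro a ha b hb hab
      rcases mem_insert.1 ha with ha' | ha' <;> rcases mem_insert.1 hb with hb' | hb'
      · exact absurd (hb'.trans ha'.symm) hab.ne'
      · subst ha'
        simpa [hne' b hb'] using (hcw b hb' hab).symm
      · subst hb'
        simpa [hne' a ha'] using hcw a ha' hab.symm
      · simpa [hne' a ha', hne' b hb'] using hφ a ha' b hb' hab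
    · intro w hw
      have hwX := (mem_sdiff.1 hw).1
      have hwP : w ∉ P := fun h' => (mem_sdiff.1 hw).2 (mem_insert_of_mem h')
      have hwv : w ≠ v := fun h' => (mem_sdiff.1 hw).2 (h' ▸ mem_insert_self v P)
      have h0 := h w (mem_sdiff.2 ⟨hwX, hwP⟩)
      -- For a neighbor `w`, maximality of `ρ v` means that `v` was in the second count. It leaves
      -- that count and adds at most one color to the first, so the bound survives.
      by_cases hadj : H.Adj w v
      · have h1 : (((insert v P).filter (H.Adj w)).image (Function.update φ v c)) ∩ L w ⊆
            insert c (((P.filter (H.Adj w)).image φ) ∩ L w) := by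
          intro x hx
          obtain ⟨hx1, hx2⟩ := mem_inter.1 hx
          obtain ⟨y, hy, rfl⟩ := mem_image.1 hx1
          obtain ⟨hy1, hy2⟩ := mem_filter.1 hy
          rcases mem_insert.1 hy1 with rfl | hy1
          · simp
          · have e : Function.update φ v c y = φ y := by simp [hne' y hy1]
            rw [e] at hx2 ⊢
            exact mem_insert_of_mem (mem_inter.2 ⟨mem_image_of_mem _ (mem_filter.2 ⟨hy1, hy2⟩), hx2⟩)
        have h2 : ((X \ insert v P).filter fun u => H.Adj w u ∧ ρ w ≤ ρ u) ⊆
            ((X \ P).filter fun u => H.Adj w u ∧ ρ w ≤ ρ u).erase v := by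
          intro x hx
          obtain ⟨hx1, hx2⟩ := mem_filter.1 hx
          obtain ⟨hx3, hx4⟩ := mem_sdiff.1 hx1
          exact mem_erase.2 ⟨fun e => hx4 (e ▸ mem_insert_self _ _), mem_filter.2
            ⟨mem_sdiff.2 ⟨hx3, fun h' => hx4 (mem_insert_of_mem h')⟩, hx2⟩⟩
        have h3 : v ∈ (X \ P).filter fun u => H.Adj w u ∧ ρ w ≤ ρ u :=
          mem_filter.2 ⟨hv, hadj, hmax w (mem_sdiff.2 ⟨hwX, hwP⟩)⟩
        have h4 := card_le_card h1
        have h5 := card_le_card h2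
        have h6 := card_insert_le c (((P.filter (H.Adj w)).image φ) ∩ L w)
        rw [card_erase_of_mem h3] at h5
        have h7 := card_pos.2 ⟨v, h3⟩
        omega
      · have h1 : (((insert v P).filter (H.Adj w)).image (Function.update φ v c)) ∩ L w ⊆
            ((P.filter (H.Adj w)).image φ) ∩ L w := by
          intro x hx
          obtain ⟨hx1, hx2⟩ := mem_inter.1 hx
          obtain ⟨y, hy, rfl⟩ := mem_image.1 hx1
          obtain ⟨hy1, hy2⟩ := mem_filter.1 hy
          rcases mem_insert.1 hy1 with rfl | hy1
          · exact absurd hy2 hadj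
          · have e : Function.update φ v c y = φ y := by simp [hne' y hy1]
            rw [e] at hx2 ⊢
            exact mem_inter.2 ⟨mem_image_of_mem _ (mem_filter.2 ⟨hy1, hy2⟩), hx2⟩
        have h2 : ((X \ insert v P).filter fun u => H.Adj w u ∧ ρ w ≤ ρ u) ⊆
            ((X \ P).filter fun u => H.Adj w u ∧ ρ w ≤ ρ u) :=
          filter_subset_filter _ (sdiff_subset_sdiff Subset.rfl (subset_insert _ _))
        have h4 := card_le_card h1
        have h5 := card_le_card h2
        omega
    · rw [sdiff_insert, card_erase_of_mem hv]
      omega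

/-- To color `X` from lists it suffices to color a set on which the lists have few colors. -/
theorem ListColorableOn.exists_small_pot (H : SimpleGraph U) (X : Finset U) (L : U → Finset C) :
    ∃ S ⊆ X, (S = ∅ ∨ (S.biUnion L).card < S.card) ∧
      (H.ListColorableOn S L → H.ListColorableOn X L) := by
  set F := X.powerset.filter fun S => S = ∅ ∨ (S.biUnion L).card < S.card with hF
  obtain ⟨S, hS, hmax⟩ := exists_max_image F card ⟨∅, by simp [hF]⟩
  obtain ⟨hSX, hSv⟩ := mem_filter.1 hS
  rw [mem_powerset] at hSX
  refine ⟨S, hSX, hSv, ?_⟩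
  -- Hall's condition outside `S`, with the colors of `S` removed: a violating `T` could be added to
  -- `S`, against maximality. The resulting matching uses distinct colors that never meet those on
  -- `S`.
  have hall : ∀ T : Finset {x // x ∈ X \ S},
      T.card ≤ (T.biUnion fun x => L x \ S.biUnion L).card := by
    intro T
    by_contra! hlt
    set T' := T.map (Function.Embedding.subtype _) with hT'
    have hdisj : Disjoint S T' := by
      rw [Finset.disjoint_right]
      intro x hx
      obtain ⟨y, _, rfl⟩ := mem_map.1 hx
      exact (mem_sdiff.1 y.2).2
    have hsub : T' ⊆ X := by
      intro x hx
      obtain ⟨y, _, rfl⟩ := mem_map.1 hx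
      exact (mem_sdiff.1 y.2).1
    have hb : ((S ∪ T').biUnion L) ⊆ S.biUnion L ∪ T.biUnion fun x => L x \ S.biUnion L := by
      intro c hc
      by_cases hcS : c ∈ S.biUnion L
      · exact mem_union_left _ hcS
      · refine mem_union_right _ ?_
        obtain ⟨x, hx, hcx⟩ := mem_biUnion.1 hc
        rcases mem_union.1 hx with hx | hx
        · exact absurd (mem_biUnion.2 ⟨x, hx, hcx⟩) hcS
        · obtain ⟨y, hy, rfl⟩ := mem_map.1 hx
          exact mem_biUnion.2 ⟨y, hy, mem_sdiff.2 ⟨hcx, hcS⟩⟩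
    have h1 := (card_le_card hb).trans (card_union_le _ _)
    have h2 : (S ∪ T').card = S.card + T.card := by
      rw [card_union_of_disjoint hdisj, hT', card_map]
    have h3 : (S.biUnion L).card ≤ S.card := by
      rcases hSv with h | h
      · simp [h]
      · exact h.le
    have h4 := hmax (S ∪ T') (mem_filter.2 ⟨mem_powerset.2 (union_subset hSX hsub),
      Or.inr (by omega)⟩)
    omega
  obtain ⟨f, hf, hfL⟩ := (all_card_le_biUnion_card_iff_exists_injective _).1 hall
  rintro ⟨φ, hφL, hφ⟩
  refine ⟨fun x => if h : x ∈ X \ S then f ⟨x, h⟩ else φ x, ?_, ?_⟩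
  · intro v hv
    by_cases h : v ∈ X \ S
    · simp only [h, dif_pos]
      exact (mem_sdiff.1 (hfL ⟨v, h⟩)).1
    · simp only [h, dif_neg, not_false_eq_true]
      exact hφL v (by simpa [hv] using h)
  · have key : ∀ v (h : v ∈ X \ S), ∀ w ∈ S, f ⟨v, h⟩ ≠ φ w := fun v h w hw e =>
      (mem_sdiff.1 (hfL ⟨v, h⟩)).2 (mem_biUnion.2 ⟨w, hw, e ▸ hφL w hw⟩)
    intro v hv w hw hvw
    by_cases h : v ∈ X \ S <;> by_cases h' : w ∈ X \ S <;>
      simp only [h, h', dif_pos, dif_neg, not_false_eq_true]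
    · exact fun e => hvw.ne (congrArg Subtype.val (hf e))
    · exact key v h w (by simpa [hw] using h')
    · exact (key w h' v (by simpa [hv] using h)).symm
    · exact hφ v (by simpa [hv] using h) w (by simpa [hw] using h') hvw

/-- Nearly complete graphs without large cliques are colorable from lists that are slightly too
small for a greedy coloring. -/
theorem ListColorableOn.of_dense (H : SimpleGraph U) [DecidableRel H.Adj] [Nonempty C]
    (X Bad : Finset U) (L : U → Finset C) (m r : ℕ)
    (hr : ∀ u ∈ X, r ≤ (L u).card)
    (hgood : ∀ u ∈ X, u ∉ Bad → X.card ≤ (L u).card + m)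
    (hbad : Bad.card + m ≤ r) (hpot : X.card + m ≤ 2 * r)
    (hcl : ∀ T ⊆ X, H.IsClique (T : Set U) → T.card + 3 * m ≤ X.card) :
    H.ListColorableOn X L := by
  obtain ⟨S, hSX, hS, himp⟩ := ListColorableOn.exists_small_pot H X L
  refine himp ?_
  rcases hS with rfl | hS
  · exact ⟨fun _ => Classical.arbitrary C, by simp, by simp⟩
  have hlist : ∀ u ∈ S, (L u).card < S.card := fun u hu =>
    (card_le_card (subset_biUnion_of_mem L hu)).trans_lt hS
  have hScard := card_le_card hSX
  -- Lists on `S` are shorter than `S` itself. For a good vertex this forces `S` to be nearly all of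
  -- `X`; if all were bad, `r` would be below `Bad.card`.
  have hbig : X.card < S.card + m := by
    by_cases hSB : S ⊆ Bad
    · have h1 := card_le_card hSB
      obtain ⟨u, hu⟩ : S.Nonempty := card_pos.1 (by omega)
      have h2 := hlist u hu
      have h3 := hr u (hSX hu)
      omega
    · obtain ⟨u, hu, huB⟩ := not_subset.1 hSB
      have h2 := hlist u hu
      have h3 := hgood u (hSX hu) huB
      omega
  -- After t < m pairs, more than |X| − 3m vertices of `S` remain, too many for a clique, so a
  -- nonadjacent pair exists. Two lists inside a pot smaller than `S` share more than 2r − |S| ≥ m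
  -- colors, so one of them is still unused.
  have pairs : ∀ t ≤ m, ∃ P ⊆ S, ∃ φ : U → C, P.card = 2 * t ∧ (P.image φ).card ≤ t ∧
      (∀ v ∈ P, φ v ∈ L v) ∧ ∀ v ∈ P, ∀ w ∈ P, H.Adj v w → φ v ≠ φ w := by
    intro t
    induction t with
    | zero => intro _; exact ⟨∅, by simp, fun _ => Classical.arbitrary C, by simp⟩
    | succ t ih =>
      intro ht
      obtain ⟨P, hPS, φ, hP, hcol, hL, hφ⟩ := ih (by omega)
      have hnc : ¬ H.IsClique ((S \ P : Finset U) : Set U) := by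
        intro hc
        have h1 := hcl (S \ P) (sdiff_subset.trans hSX) hc
        rw [card_sdiff_of_subset hPS] at h1
        have := card_le_card hPS
        omega
      obtain ⟨u, hu, w, hw, huw, hnadj⟩ : ∃ u ∈ S \ P, ∃ w ∈ S \ P, u ≠ w ∧ ¬ H.Adj u w := by
        by_contra! hcon
        exact hnc fun u hu w hw huw => hcon u hu w hw huw
      obtain ⟨huS, huP⟩ := mem_sdiff.1 hu
      obtain ⟨hwS, hwP⟩ := mem_sdiff.1 hw
      obtain ⟨c, hc, hcP⟩ : ∃ c ∈ L u ∩ L w, c ∉ P.image φ := by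
        by_contra! hcon
        have h1 := card_le_card (show L u ∩ L w ⊆ P.image φ from hcon)
        have h2 := card_union_add_card_inter (L u) (L w)
        have h3 := card_le_card (union_subset (subset_biUnion_of_mem L huS)
          (subset_biUnion_of_mem L hwS))
        have h4 := hr u (hSX huS)
        have h5 := hr w (hSX hwS)
        omega
      set ψ : U → C := fun x => if x = u ∨ x = w then c else φ x with hψ
      have hψu : ψ u = c := by simp [hψ]
      have hψw : ψ w = c := by simp [hψ]
      have hψP : ∀ x ∈ P, ψ x = φ x := fun x hx => if_neg (by
        rintro (rfl | rfl)
        · exact huP hx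
        · exact hwP hx)
      have hcx : ∀ x ∈ P, φ x ≠ c := fun x hx e => hcP (e ▸ mem_image_of_mem φ hx)
      refine ⟨insert u (insert w P), ?_, ψ, ?_, ?_, ?_, ?_⟩
      · exact insert_subset huS (insert_subset hwS hPS)
      · rw [card_insert_of_notMem (by simp [huw, huP]), card_insert_of_notMem hwP, hP]
        ring
      · rw [image_insert, image_insert, hψu, hψw, insert_idem, image_congr fun x hx => hψP x hx]
        exact (card_insert_le _ _).trans (by omega)
      · intro v hv
        rcases mem_insert.1 hv with rfl | hv
        · rw [hψu]; exact (mem_inter.1 hc).1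
        rcases mem_insert.1 hv with rfl | hv
        · rw [hψw]; exact (mem_inter.1 hc).2
        · rw [hψP v hv]; exact hL v hv
      · have cross : ∀ a ∈ P, ∀ b, b = u ∨ b = w → ψ a ≠ ψ b := by
          rintro a ha b (rfl | rfl)
          · rw [hψu, hψP a ha]; exact hcx a ha
          · rw [hψw, hψP a ha]; exact hcx a ha
        have split : ∀ a ∈ insert u (insert w P), (a = u ∨ a = w) ∨ a ∈ P := by
          intro a ha; simpa [or_assoc] using ha
        intro a ha b hb hab
        rcases split a ha with ha | ha <;> rcases split b hb with hb | hb
        · exfalso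
          rcases ha with rfl | rfl <;> rcases hb with rfl | rfl
          · exact H.loopless.irrefl _ hab
          · exact hnadj hab
          · exact hnadj hab.symm
          · exact H.loopless.irrefl _ hab
        · exact (cross b hb a ha).symm
        · exact cross a ha b hb
        · rw [hψP a ha, hψP b hb]; exact hφ a ha b hb hab
  obtain ⟨P, hPS, φ, hP, hcol, hL, hφ⟩ := pairs m le_rfl
  -- Bad vertices come first: they face fewer than `Bad.card` earlier greedy neighbors and `m` pair
  -- colors. Good vertices come last and profit from the m colors saved, as 2m vertices of `S` use
  -- only m colors.
  refine ListColorableOn.of_greedy H S L (fun u => if u ∈ Bad then 1 else 0) P φ hPS hL hφ ?_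
  intro v hv
  obtain ⟨hvS, hvP⟩ := mem_sdiff.1 hv
  have h1 : (((P.filter (H.Adj v)).image φ) ∩ L v).card ≤ m :=
    (card_le_card (inter_subset_left.trans (image_subset_image (filter_subset _ _)))).trans hcol
  by_cases hvB : v ∈ Bad
  · have h2 : ((S \ P).filter fun u => H.Adj v u ∧
        (if v ∈ Bad then 1 else 0) ≤ (if u ∈ Bad then 1 else 0)) ⊆ Bad.erase v := by
      intro x hx
      obtain ⟨_, hx2, hx3⟩ := mem_filter.1 hx
      refine mem_erase.2 ⟨hx2.ne', ?_⟩
      by_contra hxB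
      simp [hvB, hxB] at hx3
    have h3 := card_le_card h2
    rw [card_erase_of_mem hvB] at h3
    have h4 := hr v (hSX hvS)
    have h5 := card_pos.2 ⟨v, hvB⟩
    omega
  · have h2 : ((S \ P).filter fun u => H.Adj v u ∧
        (if v ∈ Bad then 1 else 0) ≤ (if u ∈ Bad then 1 else 0)) ⊆ (S \ P).erase v := by
      intro x hx
      obtain ⟨hx1, hx2, _⟩ := mem_filter.1 hx
      exact mem_erase.2 ⟨hx2.ne', hx1⟩
    have h3 := card_le_card h2
    rw [card_erase_of_mem hv, card_sdiff_of_subset hPS] at h3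
    have h4 := hgood v (hSX hvS) hvB
    have h5 := card_pos.2 ⟨v, hv⟩
    rw [card_sdiff_of_subset hPS] at h5
    omega

/-! ### The random partial coloring, its savings and their concentration. -/

section RandomColoring

open scoped Classical

variable {U C : Type*} (H : SimpleGraph U) (L : U → Finset C)

/-- A tentative coloring: a color from each list, with a bit telling whether it is used. -/
abbrev Tentative (L : U → Finset C) : Type _ := ∀ x, {c // c ∈ L x} × Bool

variable {L} in
/-- The vertex `x` is active and picks the color `c`. -/
def Picks (ω : Tentative L) (c : C) (x : U) : Prop := ((ω x).1 : C) = c ∧ (ω x).2 = true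

variable {L} in
theorem picks_update {ω : Tentative L} {i : U} {t : {c // c ∈ L i} × Bool} {c : C} {x : U} :
    Picks (Function.update ω i t) c x ↔ if x = i then (t.1 : C) = c ∧ t.2 = true else Picks ω c x := by
  by_cases h : x = i
  · subst h; simp [Picks]
  · simp [Picks, h]

variable {L} in
/-- The vertex `u` picks `c`, and no neighbor with a list at least as long does. -/
def Keeps (ω : Tentative L) (c : C) (u : U) : Prop :=
  Picks ω c u ∧ ∀ x, H.Adj u x → (L u).card ≤ (L x).card → ¬ Picks ω c x

variable [Fintype U]

/-- Neighbors with a shorter list. -/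
noncomputable def lowerNbrs (v : U) : Finset U :=
  univ.filter fun u => H.Adj v u ∧ (L u).card < (L v).card

/-- Neighbors with a list at least as long. -/
noncomputable def upperNbrs (v : U) : Finset U :=
  univ.filter fun u => H.Adj v u ∧ (L v).card ≤ (L u).card

variable {L} in
/-- The neighbors with long lists that keep the color `c`. -/
noncomputable def keepers (v : U) (c : C) (ω : Tentative L) : Finset U :=
  (upperNbrs H L v).filter (Keeps H ω c)

variable {L} in
/-- The colors repeated among the keepers at `v`, and those kept that are useless for `v`. -/
noncomputable def savedColors (v : U) (ω : Tentative L) : Finset C :=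
  (univ.biUnion L).filter fun c =>
    (c ∉ L v ∧ 1 ≤ (keepers H v c ω).card) ∨ (c ∈ L v ∧ 2 ≤ (keepers H v c ω).card)

variable {L} in
/-- The number of colors saved at `v` by the tentative coloring. -/
noncomputable def gain (v : U) (ω : Tentative L) : ℕ :=
  ((lowerNbrs H L v).filter fun u => (ω u).2 = false).card + (savedColors H v ω).card

variable {H L}

theorem card_nbrs_eq (v : U) :
    (univ.filter (H.Adj v)).card = (lowerNbrs H L v).card + (upperNbrs H L v).card := by
  rw [← card_filter_add_card_filter_not (s := univ.filter (H.Adj v))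
    fun u => (L u).card < (L v).card, filter_filter, filter_filter]
  simp [lowerNbrs, upperNbrs]

/-- Keepers form a properly colored set `P`, and the rest is colored in decreasing order of list
length. When `v` is reached, a shorter-list neighbor outside `P` is still uncolored and forbids
nothing. A longer-list neighbor costs at most one color, and each saved color lowers that total by
at least one. So at most d(v) − gain colors are forbidden. -/
theorem ListColorableOn.of_gain (ω : Tentative L) (s : U → ℕ)
    (hd : ∀ v, (univ.filter (H.Adj v)).card ≤ (L v).card + s v)
    (hg : ∀ v, s v < gain H v ω) : H.ListColorableOn univ L := by
  set φ : U → C := fun x => (ω x).1 with hφ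
  set P : Finset U := univ.filter fun u => Keeps H ω (φ u) u with hP
  have hmem : ∀ u, u ∈ P ↔ Keeps H ω (φ u) u := fun u => by simp [hP]
  have hproper : ∀ v ∈ P, ∀ w ∈ P, H.Adj v w → (L v).card ≤ (L w).card → φ v ≠ φ w := by
    intro v hv w hw hvw hle e
    exact ((hmem v).1 hv).2 w hvw hle (e ▸ ((hmem w).1 hw).1)
  refine ListColorableOn.of_greedy H univ L (fun x => (L x).card) P φ (subset_univ _)
    (fun v _ => (ω v).1.2) ?_ ?_
  · intro v hv w hw hvw
    rcases le_total (L v).card (L w).card with h | h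
    · exact hproper v hv w hw hvw h
    · exact (hproper w hw v hv hvw.symm h).symm
  intro v hv
  have hfib : ∀ c, ((upperNbrs H L v ∩ P).filter fun u => φ u = c) = keepers H v c ω := by
    intro c
    ext u
    simp only [keepers, mem_filter, mem_inter, hmem]
    constructor
    · rintro ⟨⟨h1, h2⟩, rfl⟩; exact ⟨h1, h2⟩
    · rintro ⟨h1, h2⟩
      have e : φ u = c := h2.1.1
      exact ⟨⟨h1, e.symm ▸ h2⟩, e⟩
  have h1 : ((P.filter (H.Adj v)).image φ) ∩ L v ⊆
      (lowerNbrs H L v ∩ P).image φ ∪ ((upperNbrs H L v ∩ P).image φ ∩ L v) := by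
    intro c hc
    obtain ⟨hc1, hc2⟩ := mem_inter.1 hc
    obtain ⟨u, hu, rfl⟩ := mem_image.1 hc1
    obtain ⟨huP, hvu⟩ := mem_filter.1 hu
    rcases lt_or_ge (L u).card (L v).card with h | h
    · exact mem_union_left _ (mem_image_of_mem _ (mem_inter.2 ⟨by simp [lowerNbrs, hvu, h], huP⟩))
    · exact mem_union_right _ (mem_inter.2
        ⟨mem_image_of_mem _ (mem_inter.2 ⟨by simp [upperNbrs, hvu, h], huP⟩), hc2⟩)
  have h2 : (lowerNbrs H L v ∩ P).card +
      ((lowerNbrs H L v).filter fun u => (ω u).2 = false).card ≤ (lowerNbrs H L v).card := by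
    rw [← card_union_of_disjoint]
    · exact card_le_card (union_subset inter_subset_left (filter_subset _ _))
    · rw [Finset.disjoint_left]
      intro u hu hu'
      have := ((hmem u).1 (mem_inter.1 hu).2).1.2
      rw [(mem_filter.1 hu').2] at this
      exact absurd this (by simp)
  have h3 : ((univ \ P).filter fun u => H.Adj v u ∧ (L v).card ≤ (L u).card) =
      upperNbrs H L v \ P := by
    ext u; simp only [upperNbrs, mem_filter, mem_sdiff, mem_univ, true_and]; tauto
  have h4 : ((upperNbrs H L v ∩ P).image φ ∩ L v).card + (savedColors H v ω).card ≤
      (upperNbrs H L v ∩ P).card := by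
    have hsub : (upperNbrs H L v ∩ P).image φ ∩ L v =
        (univ.biUnion L).filter fun c => c ∈ (upperNbrs H L v ∩ P).image φ ∩ L v := by
      rw [filter_mem_eq_inter]
      refine (inter_eq_right.2 fun c hc => ?_).symm
      exact mem_biUnion.2 ⟨v, mem_univ v, (mem_inter.1 hc).2⟩
    have hmaps : ∀ u ∈ upperNbrs H L v ∩ P, φ u ∈ univ.biUnion L := fun u _ =>
      mem_biUnion.2 ⟨u, mem_univ u, (ω u).1.2⟩
    rw [hsub, savedColors, card_filter, card_filter, ← sum_add_distrib,
      card_eq_sum_card_fiberwise hmaps]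
    refine sum_le_sum fun c _ => ?_
    rw [hfib c]
    by_cases hcv : c ∈ L v
    · by_cases hci : c ∈ (upperNbrs H L v ∩ P).image φ
      · have : 1 ≤ (keepers H v c ω).card := by
          obtain ⟨u, hu, hc⟩ := mem_image.1 hci
          rw [← hfib c]
          exact card_pos.2 ⟨u, mem_filter.2 ⟨hu, hc⟩⟩
        simp only [mem_inter, hci, hcv, and_self, if_true, not_true_eq_false, false_and,
          true_and, false_or]
        split_ifs <;> omega
      · simp only [mem_inter, hci, hcv, false_and, if_false, not_true_eq_false, true_and, false_or]
        split_ifs <;> omega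
    · simp only [mem_inter, hcv, and_false, if_false, not_false_eq_true, true_and, false_and,
        or_false]
      split_ifs <;> omega
  have h5 := (card_le_card h1).trans (card_union_le _ _)
  have h6 := card_image_le (s := lowerNbrs H L v ∩ P) (f := φ)
  have h7 := card_inter_add_card_sdiff (upperNbrs H L v) P
  have h8 := hd v
  have h9 := hg v
  rw [card_nbrs_eq (L := L)] at h8
  rw [gain] at h9
  rw [h3]
  omega

theorem keepers_congr {v : U} {c : C} {ω ω' : Tentative L}
    (h1 : ∀ u, H.Adj v u → (Picks ω c u ↔ Picks ω' c u))
    (h2 : ∀ u, H.Adj v u → Picks ω c u → ∀ x, H.Adj u x → (Picks ω c x ↔ Picks ω' c x)) :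
    keepers H v c ω = keepers H v c ω' := by
  refine filter_congr fun u hu => ?_
  have hvu : H.Adj v u := (mem_filter.1 hu).2.1
  constructor
  · rintro ⟨hp, hk⟩
    exact ⟨(h1 u hvu).1 hp, fun x hux hle hx => hk x hux hle ((h2 u hvu hp x hux).2 hx)⟩
  · rintro ⟨hp, hk⟩
    have hp' := (h1 u hvu).2 hp
    exact ⟨hp', fun x hux hle hx => hk x hux hle ((h2 u hvu hp' x hux).1 hx)⟩

/-- Vertices beyond the neighborhood matter only through colors that some neighbor of `v` picks. The
local lemma needs just the locality; concentration needs this finer form. -/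
theorem gain_congr {v : U} {ω ω' : Tentative L} (h0 : ∀ u, H.Adj v u → ω u = ω' u)
    (h : ∀ c u, H.Adj v u → Picks ω c u → ∀ x, H.Adj u x → (Picks ω c x ↔ Picks ω' c x)) :
    gain H v ω = gain H v ω' := by
  have hk : ∀ c, keepers H v c ω = keepers H v c ω' := fun c =>
    keepers_congr (fun u hu => by rw [Picks, Picks, h0 u hu]) (h c)
  rw [gain, gain, savedColors, savedColors]
  simp_rw [hk]
  congr 2
  refine filter_congr fun u hu => ?_
  rw [h0 u (mem_filter.1 hu).2.1]

/-- The 3 is one activity bit plus the old and the new color at `i`; no other color changes status.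
-/
theorem abs_gain_update_sub_le (v : U) (ω : Tentative L) (i : U) (t : {c // c ∈ L i} × Bool) :
    |(gain H v (Function.update ω i t) : ℝ) - gain H v ω| ≤ 3 := by
  have one : ∀ (ω : Tentative L) (t : {c // c ∈ L i} × Bool),
      gain H v (Function.update ω i t) ≤ gain H v ω + 3 := by
    intro ω t
    have hA : ((lowerNbrs H L v).filter fun u => (Function.update ω i t u).2 = false) ⊆
        insert i ((lowerNbrs H L v).filter fun u => (ω u).2 = false) := by
      intro u hu
      by_cases h : u = i
      · simp [h]
      · rw [mem_filter, Function.update_of_ne h] at hu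
        exact mem_insert_of_mem (mem_filter.2 hu)
    have hB : savedColors H v (Function.update ω i t) ⊆
        insert (t.1 : C) (insert ((ω i).1 : C) (savedColors H v ω)) := by
      intro c hc
      by_cases h1 : c = t.1
      · simp [h1]
      by_cases h2 : c = (ω i).1
      · simp [h2]
      have hp : ∀ x, Picks (Function.update ω i t) c x ↔ Picks ω c x := by
        intro x
        rw [picks_update]
        split_ifs with hx
        · subst hx
          simp [Picks, Ne.symm h1, Ne.symm h2]
        · rfl
      have hk := keepers_congr (H := H) (v := v) (fun u _ => hp u) fun u _ _ x _ => hp x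
      refine mem_insert_of_mem (mem_insert_of_mem ?_)
      rw [savedColors, mem_filter, hk] at hc
      rw [savedColors, mem_filter]
      exact hc
    have h1 := (card_le_card hA).trans (card_insert_le _ _)
    have h2 := ((card_le_card hB).trans (card_insert_le _ _)).trans
      (Nat.add_le_add_right (card_insert_le _ _) 1)
    rw [gain, gain]
    omega
  have h1 := one ω t
  have h2 := one (Function.update ω i t) (ω i)
  rw [Function.update_idem, Function.update_eq_self] at h2
  rw [abs_le]
  have h1' : (gain H v (Function.update ω i t) : ℝ) ≤ gain H v ω + 3 := by exact_mod_cast h1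
  have h2' : (gain H v ω : ℝ) ≤ gain H v (Function.update ω i t) + 3 := by exact_mod_cast h2
  constructor <;> linarith

/-- The number of saved colors is concentrated. -/
theorem expect_exp_gain_le (hne : ∀ x, (L x).Nonempty) (v : U) {l q D : ℝ} (hl : 0 ≤ l)
    (hl6 : 6 * l ≤ 1) (hq : 0 < q) (hLq : ∀ x, q ≤ (L x).card)
    (hD : ∀ x, ((univ.filter (H.Adj x)).card : ℝ) ≤ D) :
    𝔼 ω : Tentative L, Real.exp (-l * gain H v ω) ≤
      Real.exp (-l * (𝔼 ω : Tentative L, (gain H v ω : ℝ)) + 9 * l ^ 2 * (D + D ^ 2 / q)) := by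
  have hnonempty : ∀ x, Nonempty ({c // c ∈ L x} × Bool) := fun x => by
    obtain ⟨c, hc⟩ := hne x
    exact ⟨(⟨c, hc⟩, true)⟩
  set N : Finset U := univ.filter fun x => ¬ H.Adj v x with hN
  set G : Tentative L → ℝ := fun ω => 𝔼 ω' : Tentative L, (gain H v (N.piecewise ω' ω) : ℝ) with hG
  have hD0 : 0 ≤ D := (Nat.cast_nonneg _).trans (hD v)
  have hpu : ∀ (ω ω' : Tentative L) i (t : {c // c ∈ L i} × Bool), i ∈ N →
      N.piecewise (Function.update ω' i t) ω = Function.update (N.piecewise ω' ω) i t := by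
    intro ω ω' i t hi
    ext1 j
    by_cases hj : j = i
    · subst hj; simp [hi]
    · by_cases hjs : j ∈ N <;> simp [hj, hjs]
  have hpu' : ∀ (ω ω' : Tentative L) i (t : {c // c ∈ L i} × Bool), i ∉ N →
      N.piecewise (Function.update ω' i t) ω = N.piecewise ω' ω := by
    intro ω ω' i t hi
    ext1 j
    by_cases hj : j = i
    · subst hj; simp [hi]
    · by_cases hjs : j ∈ N <;> simp [hj, hjs]
  have hpv : ∀ (ω ω' : Tentative L) i (t : {c // c ∈ L i} × Bool), i ∉ N →
      N.piecewise ω' (Function.update ω i t) = Function.update (N.piecewise ω' ω) i t := by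
    intro ω ω' i t hi
    ext1 j
    by_cases hj : j = i
    · subst hj; simp [hi]
    · by_cases hjs : j ∈ N <;> simp [hj, hjs]
  have hpv' : ∀ (ω ω' : Tentative L) i (t : {c // c ∈ L i} × Bool), i ∈ N →
      N.piecewise ω' (Function.update ω i t) = N.piecewise ω' ω := by
    intro ω ω' i t hi
    ext1 j
    by_cases hj : j = i
    · subst hj; simp [hi]
    · by_cases hjs : j ∈ N <;> simp [hj, hjs]
  have outer : ∀ ω : Tentative L,
      𝔼 ω' : Tentative L, Real.exp (-l * gain H v (N.piecewise ω' ω)) ≤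
        Real.exp (-l * G ω + 9 * l ^ 2 * (D ^ 2 / q)) := by
    intro ω
    -- With the neighbors frozen, `i` matters only when it actively picks a color chosen by a common
    -- neighbor of `i` and `v`. The density is at most codegree/q, and the codegrees sum to at most
    -- D².
    set R : ∀ i, Set ({c // c ∈ L i} × Bool) := fun i =>
      {t | i ∈ N ∧ ∃ u, H.Adj v u ∧ H.Adj u i ∧ ((ω u).1 : C) = t.1 ∧ t.2 = true} with hR
    have hmain := expect_exp_le (fun ω' : Tentative L => (gain H v (N.piecewise ω' ω) : ℝ)) R
      (c := 3) (l := l) (fun i => ((univ.filter fun u => H.Adj v u ∧ H.Adj u i).card : ℝ) / q)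
      hl (by linarith) ?_ ?_ ?_
    · refine hmain.trans (Real.exp_le_exp.2 (add_le_add le_rfl ?_))
      rw [← sum_div]
      have hdc : ∑ i, ((univ.filter fun u => H.Adj v u ∧ H.Adj u i).card : ℝ) ≤ D ^ 2 := by
        have : ∑ i, ((univ.filter fun u => H.Adj v u ∧ H.Adj u i).card : ℝ) =
            ∑ u ∈ univ.filter (H.Adj v), ((univ.filter (H.Adj u)).card : ℝ) := by
          simp_rw [card_filter]
          push_cast
          rw [sum_comm, sum_filter]
          refine sum_congr rfl fun u _ => ?_
          by_cases h : H.Adj v u <;> simp [h]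
        rw [this]
        calc _ ≤ ∑ u ∈ univ.filter (H.Adj v), D := sum_le_sum fun u _ => hD u
          _ = (univ.filter (H.Adj v)).card * D := by rw [sum_const, nsmul_eq_mul]
          _ ≤ D * D := by gcongr; exact hD v
          _ = D ^ 2 := by ring
      have : (∑ i, ((univ.filter fun u => H.Adj v u ∧ H.Adj u i).card : ℝ)) / q ≤ D ^ 2 / q := by
        gcongr
      nlinarith [sq_nonneg l]
    · intro ω' i t
      by_cases hi : i ∈ N
      · rw [hpu _ _ _ _ hi]; exact abs_gain_update_sub_le _ _ _ _
      · rw [hpu' _ _ _ _ hi]; simp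
    · intro ω' i t hωi ht
      by_cases hi : i ∈ N
      · rw [hpu _ _ _ _ hi]
        congr 1
        have hvi : ¬ H.Adj v i := (mem_filter.1 hi).2
        have hNu : ∀ u, H.Adj v u → N.piecewise ω' ω u = ω u := fun u hu =>
          piecewise_eq_of_notMem _ _ _ (by simp [hN, hu])
        refine (gain_congr (fun u hu => ?_) fun c u hvu hp x hux => ?_).symm
        · rw [Function.update_of_ne]
          rintro rfl
          exact hvi hu
        · rw [picks_update]
          split_ifs with hx
          · subst hx
            have hc : ((ω u).1 : C) = c := by rw [← hp.1, hNu u hvu]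
            have e1 : ¬ ((t.1 : C) = c ∧ t.2 = true) := fun h =>
              ht ⟨hi, u, hvu, hux, hc.trans h.1.symm, h.2⟩
            have e2 : ¬ Picks (N.piecewise ω' ω) c x := by
              rw [Picks, piecewise_eq_of_mem _ _ _ hi]
              exact fun h => hωi ⟨hi, u, hvu, hux, hc.trans h.1.symm, h.2⟩
            exact iff_of_false e2 e1
          · rfl
      · rw [hpu' _ _ _ _ hi]
    · intro i
      have hcardpos : (0 : ℝ) < (L i).card := hq.trans_le (hLq i)
      rw [Fintype.expect_eq_sum_div_card, sum_boole]
      have hle : (univ.filter fun t => t ∈ R i).card ≤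
          (univ.filter fun u => H.Adj v u ∧ H.Adj u i).card := by
        have hinj : ((univ.filter fun t => t ∈ R i).image fun t => (t.1 : C)).card =
            (univ.filter fun t => t ∈ R i).card := by
          refine card_image_of_injOn ?_
          intro t ht t' ht' e
          simp only [coe_filter, mem_univ, true_and, Set.mem_ofPred_eq] at ht ht'
          obtain ⟨_, _, _, _, _, h1⟩ := ht
          obtain ⟨_, _, _, _, _, h2⟩ := ht'
          exact Prod.ext (Subtype.ext e) (h1.trans h2.symm)
        rw [← hinj]
        refine (card_le_card (t := (univ.filter fun u => H.Adj v u ∧ H.Adj u i).image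
          fun u => ((ω u).1 : C)) ?_).trans card_image_le
        intro c hc
        obtain ⟨t, ht, rfl⟩ := mem_image.1 hc
        obtain ⟨_, u, h1, h2, h3, _⟩ := (mem_filter.1 ht).2
        exact mem_image.2 ⟨u, by simp [h1, h2], h3⟩
      refine div_le_div₀ (Nat.cast_nonneg _) (by exact_mod_cast hle) hq ?_
      simp only [Fintype.card_prod, Fintype.card_coe, Fintype.card_bool]
      push_cast
      linarith [hLq i]
  have inner : 𝔼 ω : Tentative L, Real.exp (-l * G ω) ≤
      Real.exp (-l * (𝔼 ω : Tentative L, G ω) + 9 * l ^ 2 * D) := by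
    -- For the average `G` over non-neighbors only the at most D neighbors matter, each with the
    -- trivial density 1.
    set R : ∀ i, Set ({c // c ∈ L i} × Bool) := fun i => {t | H.Adj v i} with hR
    have hmain := expect_exp_le G R (c := 3) (l := l) (fun i => if H.Adj v i then 1 else 0)
      hl (by linarith) ?_ ?_ ?_
    · refine hmain.trans (Real.exp_le_exp.2 (add_le_add le_rfl ?_))
      rw [sum_boole]
      nlinarith [sq_nonneg l, hD v]
    · intro ω i t
      rw [hG]
      simp only
      rw [← expect_sub_distrib]
      refine (abs_expect_le _ _).trans ?_
      refine (expect_le_expect (g := fun _ => 3) fun ω' _ => ?_).trans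
        (by rw [Fintype.expect_const])
      by_cases hi : i ∈ N
      · rw [hpv' _ _ _ _ hi]; simp
      · rw [hpv _ _ _ _ hi]; exact abs_gain_update_sub_le _ _ _ _
    · intro ω i t hi _
      have hi' : i ∈ N := by simpa [hR, hN] using hi
      simp only [hG, hpv' _ _ _ _ hi']
    · intro i
      by_cases h : H.Adj v i
      · simp [hR, h]
      · simp [hR, h]
  have hEG : 𝔼 ω : Tentative L, G ω = 𝔼 ω : Tentative L, (gain H v ω : ℝ) := by
    rw [← expect_piecewise N fun ω : Tentative L => (gain H v ω : ℝ), expect_comm]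
  rw [← expect_piecewise N fun ω : Tentative L => Real.exp (-l * gain H v ω), expect_comm]
  calc _ ≤ 𝔼 ω : Tentative L, Real.exp (-l * G ω) * Real.exp (9 * l ^ 2 * (D ^ 2 / q)) := by
        refine expect_le_expect fun ω _ => ?_
        rw [← Real.exp_add]
        exact outer ω
    _ = (𝔼 ω : Tentative L, Real.exp (-l * G ω)) * Real.exp (9 * l ^ 2 * (D ^ 2 / q)) := by
        rw [expect_mul]
    _ ≤ Real.exp (-l * (𝔼 ω : Tentative L, G ω) + 9 * l ^ 2 * D) *
          Real.exp (9 * l ^ 2 * (D ^ 2 / q)) := by gcongr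
    _ = _ := by rw [← Real.exp_add, hEG]; congr 1; ring

/-- A tentative coloring saving more than `s v` colors at every vertex `v` exists when the
expected savings exceed `s v` by a suitable margin. -/
theorem exists_gain (hne : ∀ x, (L x).Nonempty) (s : U → ℕ) {l q D t : ℝ} (hl : 0 ≤ l)
    (hl6 : 6 * l ≤ 1) (hq : 0 < q) (hLq : ∀ x, q ≤ (L x).card) (hD1 : 1 ≤ D)
    (hD : ∀ x, ((univ.filter (H.Adj x)).card : ℝ) ≤ D)
    (hE : ∀ v, s v + t ≤ 𝔼 ω : Tentative L, (gain H v ω : ℝ))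
    (hsmall : 64 * D ^ 4 * Real.exp (-l * t + 9 * l ^ 2 * (D + D ^ 2 / q)) ≤ 1) :
    ∃ ω : Tentative L, ∀ v, s v < gain H v ω := by
  have hnonempty : ∀ x, Nonempty ({c // c ∈ L x} × Bool) := fun x => by
    obtain ⟨c, hc⟩ := hne x
    exact ⟨(⟨c, hc⟩, true)⟩
  -- The gain at `v` is determined within two steps of `v`. These sets have at most 2D² elements and
  -- the relation is symmetric, so each event meets at most 4D⁴ events.
  set S : U → Finset U := fun v =>
    univ.filter (H.Adj v) ∪ (univ.filter (H.Adj v)).biUnion fun u => univ.filter (H.Adj u) with hS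
  have hSmem : ∀ v x, x ∈ S v ↔ H.Adj v x ∨ ∃ u, H.Adj v u ∧ H.Adj u x := by
    intro v x; simp [hS]
  have hSsymm : ∀ v x, x ∈ S v → v ∈ S x := by
    intro v x
    rw [hSmem, hSmem]
    rintro (h | ⟨u, h1, h2⟩)
    · exact Or.inl h.symm
    · exact Or.inr ⟨u, h2.symm, h1.symm⟩
  have hScard : ∀ v, ((S v).card : ℝ) ≤ 2 * D ^ 2 := by
    intro v
    have h1 : ((S v).card : ℝ) ≤ (univ.filter (H.Adj v)).card +
        ∑ u ∈ univ.filter (H.Adj v), ((univ.filter (H.Adj u)).card : ℝ) := by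
      exact_mod_cast (card_union_le _ _).trans (Nat.add_le_add_left card_biUnion_le _)
    have h2 : ∑ u ∈ univ.filter (H.Adj v), ((univ.filter (H.Adj u)).card : ℝ) ≤ D * D := by
      calc _ ≤ ∑ u ∈ univ.filter (H.Adj v), D := sum_le_sum fun u _ => hD u
        _ = (univ.filter (H.Adj v)).card * D := by rw [sum_const, nsmul_eq_mul]
        _ ≤ D * D := by gcongr; exact hD v
    nlinarith [hD v]
  set p := Real.exp (-l * t + 9 * l ^ 2 * (D + D ^ 2 / q)) with hp
  have hp0 : 0 < p := Real.exp_pos _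
  have hdep : ∀ v, ((univ.filter fun w => ¬ Disjoint (S v) (S w)).card : ℝ) ≤ 4 * D ^ 4 := by
    intro v
    have hsub : (univ.filter fun w => ¬ Disjoint (S v) (S w)) ⊆ (S v).biUnion S := by
      intro w hw
      obtain ⟨x, hx1, hx2⟩ := not_disjoint_iff.1 (mem_filter.1 hw).2
      exact mem_biUnion.2 ⟨x, hx1, hSsymm _ _ hx2⟩
    have h1 : ((univ.filter fun w => ¬ Disjoint (S v) (S w)).card : ℝ) ≤
        ∑ x ∈ S v, ((S x).card : ℝ) := by
      exact_mod_cast (card_le_card hsub).trans card_biUnion_le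
    calc _ ≤ ∑ x ∈ S v, ((S x).card : ℝ) := h1
      _ ≤ ∑ x ∈ S v, 2 * D ^ 2 := sum_le_sum fun x _ => hScard x
      _ = (S v).card * (2 * D ^ 2) := by rw [sum_const, nsmul_eq_mul]
      _ ≤ 2 * D ^ 2 * (2 * D ^ 2) := by gcongr; exact hScard v
      _ = 4 * D ^ 4 := by ring
  have hfloor : ((⌊4 * D ^ 4⌋₊ : ℕ) : ℝ) ≤ 4 * D ^ 4 := Nat.floor_le (by positivity)
  have hD4 : 1 ≤ D ^ 4 := one_le_pow₀ hD1
  have hLLL := exists_avoiding (α := fun x => {c // c ∈ L x} × Bool)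
    (fun v ω => gain H v ω ≤ s v) S ?_ (p := p) ⌊4 * D ^ 4⌋₊ ?_ ?_ ?_ ?_
  · obtain ⟨ω, hω⟩ := hLLL
    exact ⟨ω, fun v => not_le.1 (hω v)⟩
  · intro v ω ω' h
    have e : gain H v ω = gain H v ω' :=
      gain_congr (fun u hu => h u ((hSmem _ _).2 (Or.inl hu))) fun c u hvu _ x hux => by
        rw [Picks, Picks, h x ((hSmem _ _).2 (Or.inr ⟨u, hvu, hux⟩))]
    rw [e]
  · intro v
    have hmarkov : ∀ ω : Tentative L, (if gain H v ω ≤ s v then (1 : ℝ) else 0) ≤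
        Real.exp (l * s v) * Real.exp (-l * gain H v ω) := by
      intro ω
      split_ifs with h
      · rw [← Real.exp_add]
        refine Real.one_le_exp ?_
        have : (gain H v ω : ℝ) ≤ s v := by exact_mod_cast h
        nlinarith
      · positivity
    calc _ ≤ 𝔼 ω : Tentative L, Real.exp (l * s v) * Real.exp (-l * gain H v ω) :=
          expect_le_expect fun ω _ => hmarkov ω
      _ = Real.exp (l * s v) * 𝔼 ω : Tentative L, Real.exp (-l * gain H v ω) := by rw [mul_expect]
      _ ≤ Real.exp (l * s v) * Real.exp (-l * (𝔼 ω : Tentative L, (gain H v ω : ℝ)) +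
            9 * l ^ 2 * (D + D ^ 2 / q)) := by
          gcongr
          exact expect_exp_gain_le hne v hl hl6 hq hLq hD
      _ ≤ p := by
          rw [← Real.exp_add, hp, Real.exp_le_exp]
          nlinarith [hE v]
  · intro v
    exact Nat.le_floor (hdep v)
  · calc 4 * p * (⌊4 * D ^ 4⌋₊ : ℕ) ≤ 4 * p * (4 * D ^ 4) := by gcongr
      _ ≤ 1 := by nlinarith [mul_pos hp0 (by positivity : 0 < D ^ 4)]
  · nlinarith

end RandomColoring

/-! ### Lower bound for the expected savings. -/

section ExpectedGain

open scoped Classical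

variable {U C : Type*} {H : SimpleGraph U} {L : U → Finset C}

/-- Within `Z ∪ A`, exactly the vertices of `A` pick `c`. -/
def PicksExactly (A Z : Finset U) (c : C) (ω : Tentative L) : Prop :=
  (∀ x ∈ A, Picks ω c x) ∧ ∀ x ∈ Z, x ∉ A → ¬ Picks ω c x

/-- Stands in for a correlation inequality: factors on the overlap are counted twice, which only
loses. -/
theorem prod_mul_prod_le_prod_union (A B : Finset U) (f : U → ℝ) (h0 : ∀ x, 0 ≤ f x)
    (h1 : ∀ x, f x ≤ 1) : (∏ x ∈ A, f x) * ∏ x ∈ B, f x ≤ ∏ x ∈ A ∪ B, f x := by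
  rw [← prod_union_inter]
  exact mul_le_of_le_one_right (prod_nonneg fun x _ => h0 x)
    (prod_le_one (fun x _ => h0 x) fun x _ => h1 x)

variable [Fintype U]

/-- The event is a box. Vertices of `Z` in `A`, or without `c` in their list, need no factor from
the second product; including it is harmless because it is at most 1. -/
theorem le_expect_picksExactly (hne : ∀ x, (L x).Nonempty) (A Z : Finset U) (c : C)
    (hc : ∀ x ∈ A, c ∈ L x) :
    (∏ x ∈ A, 1 / (2 * (L x).card : ℝ)) * ∏ x ∈ Z, (1 - 1 / (2 * (L x).card : ℝ)) ≤
      𝔼 ω : Tentative L, (if PicksExactly A Z c ω then (1 : ℝ) else 0) := by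
  set B : ∀ x, Finset ({c // c ∈ L x} × Bool) := fun x => univ.filter fun t =>
    (x ∈ A → (t.1 : C) = c ∧ t.2 = true) ∧ (x ∈ Z → x ∉ A → ¬ ((t.1 : C) = c ∧ t.2 = true)) with hB
  have hE : ∀ ω : Tentative L, PicksExactly A Z c ω ↔ ∀ x, ω x ∈ B x := by
    intro ω
    simp only [PicksExactly, Picks, hB, mem_filter, mem_univ, true_and, forall_and]
  simp_rw [hE]
  rw [expect_box, ← Fintype.prod_ite_mem A, ← Fintype.prod_ite_mem Z, ← prod_mul_distrib]
  have hpos : ∀ x, (1 : ℝ) ≤ (L x).card := fun x => by exact_mod_cast card_pos.2 (hne x)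
  refine prod_le_prod (fun x _ => ?_) fun x _ => ?_
  · have h1 := hpos x
    have h2 : 1 / (2 * (L x).card : ℝ) ≤ 1 := by
      rw [div_le_one (by linarith)]; linarith
    refine mul_nonneg ?_ ?_ <;> split_ifs <;> positivity
  · have h1 := hpos x
    have h2 : 1 / (2 * (L x).card : ℝ) ≤ 1 := by
      rw [div_le_one (by linarith)]; linarith
    have h3 : 0 ≤ 1 / (2 * (L x).card : ℝ) := by positivity
    have hα : (Fintype.card ({c // c ∈ L x} × Bool) : ℝ) = 2 * (L x).card := by
      simp only [Fintype.card_prod, Fintype.card_coe, Fintype.card_bool]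
      push_cast; ring
    rw [hα]
    by_cases hA : x ∈ A
    · have hcard : 1 ≤ (B x).card :=
        card_pos.2 ⟨(⟨c, hc x hA⟩, true), by simp [hB, hA]⟩
      have hle : 1 / (2 * (L x).card : ℝ) ≤ (B x).card / (2 * (L x).card : ℝ) := by
        gcongr; exact_mod_cast hcard
      rw [if_pos hA]
      refine le_trans ?_ hle
      split_ifs <;> nlinarith
    · rw [if_neg hA, one_mul]
      by_cases hZ : x ∈ Z
      · rw [if_pos hZ]
        have hcompl : (B x)ᶜ.card ≤ 1 := by
          refine card_le_one.2 ?_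
          intro t ht t' ht'
          simp only [hB, hA, hZ, mem_compl, mem_filter, mem_univ, true_and, IsEmpty.forall_iff,
            not_false_eq_true, forall_true_left, not_not] at ht ht'
          exact Prod.ext (Subtype.ext (ht.1.trans ht'.1.symm)) (ht.2.trans ht'.2.symm)
        have hsum := card_add_card_compl (B x)
        have hge : (2 * (L x).card : ℝ) ≤ (B x).card + 1 := by
          rw [← hα]
          exact_mod_cast (by omega : Fintype.card ({c // c ∈ L x} × Bool) ≤ (B x).card + 1)
        rw [one_sub_div (by linarith)]
        gcongr
        linarith
      · rw [if_neg hZ]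
        have : B x = univ := by simp [hB, hA, hZ]
        rw [this, card_univ, hα, div_self (by linarith)]

/-- This is why conflicts favor longer lists: each of the at most 1.02|L(u)| rivals has a factor at
least 1 − 1/(2|L(u)|), and Bernoulli's inequality leaves 1 − 0.51. -/
theorem le_prod_upperNbrs (hne : ∀ x, (L x).Nonempty) (u : U)
    (hdeg : 100 * (univ.filter (H.Adj u)).card ≤ 102 * (L u).card) :
    (0.49 : ℝ) ≤ ∏ x ∈ upperNbrs H L u, (1 - 1 / (2 * (L x).card : ℝ)) := by
  have h1 : (1 : ℝ) ≤ (L u).card := by exact_mod_cast card_pos.2 (hne u)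
  have h2 : 1 / (2 * (L u).card : ℝ) ≤ 1 := by
    rw [div_le_one (by linarith)]; linarith
  have hcard : 100 * ((upperNbrs H L u).card : ℝ) ≤ 102 * (L u).card := by
    have := card_nbrs_eq (H := H) (L := L) u
    exact_mod_cast (by omega : 100 * (upperNbrs H L u).card ≤ 102 * (L u).card)
  calc (0.49 : ℝ) ≤ 1 + (upperNbrs H L u).card * (-(1 / (2 * (L u).card : ℝ))) := by
        have : (upperNbrs H L u).card * (1 / (2 * (L u).card : ℝ)) ≤ 0.51 := by
          rw [mul_one_div, div_le_iff₀ (by linarith)]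
          linarith
        linarith
    _ ≤ (1 + -(1 / (2 * (L u).card : ℝ))) ^ (upperNbrs H L u).card :=
        one_add_mul_le_pow (by linarith) _
    _ = ∏ x ∈ upperNbrs H L u, (1 - 1 / (2 * (L u).card : ℝ)) := by
        rw [prod_const, sub_eq_add_neg]
    _ ≤ _ := by
        refine prod_le_prod (fun x _ => by linarith) fun x hx => ?_
        have : ((L u).card : ℝ) ≤ (L x).card := by exact_mod_cast (mem_filter.1 hx).2.2
        gcongr

theorem keeps_of_picksExactly {A Z : Finset U} {c : C} {ω : Tentative L} {u : U}
    (h : PicksExactly A Z c ω) (hu : u ∈ A) (hZ : upperNbrs H L u ⊆ Z)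
    (hA : ∀ x ∈ A, ¬ H.Adj u x) : Keeps H ω c u :=
  ⟨h.1 u hu, fun x hux hle => h.2 x (hZ (by simp [upperNbrs, hux, hle])) fun hx => hA x hx hux⟩

/-- Saved colors come from isolated useless picks and isolated pairs of equal picks. -/
theorem card_picksExactly_le (v : U) (E : Finset (U × U))
    (hE : ∀ e ∈ E, e.1 ∈ upperNbrs H L v ∧ e.2 ∈ upperNbrs H L v ∧ e.1 ≠ e.2 ∧ ¬ H.Adj e.1 e.2)
    (ω : Tentative L) (c : C) :
    2 * ((upperNbrs H L v).filter fun u => (c ∈ L u ∧ c ∉ L v) ∧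
        PicksExactly {u} (upperNbrs H L u ∪ upperNbrs H L v) c ω).card +
      (E.filter fun e => (c ∈ L e.1 ∧ c ∈ L e.2 ∧ c ∈ L v) ∧
        PicksExactly {e.1, e.2} (upperNbrs H L e.1 ∪ upperNbrs H L e.2 ∪ upperNbrs H L v) c ω).card
      ≤ 2 * if (c ∉ L v ∧ 1 ≤ (keepers H v c ω).card) ∨ (c ∈ L v ∧ 2 ≤ (keepers H v c ω).card)
        then 1 else 0 := by
  by_cases hcv : c ∈ L v
  · have h1 : ((upperNbrs H L v).filter fun u => (c ∈ L u ∧ c ∉ L v) ∧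
        PicksExactly {u} (upperNbrs H L u ∪ upperNbrs H L v) c ω) = ∅ := by
      simp [hcv]
    rw [h1, card_empty, mul_zero, zero_add]
    set E' := E.filter fun e => (c ∈ L e.1 ∧ c ∈ L e.2 ∧ c ∈ L v) ∧
        PicksExactly {e.1, e.2} (upperNbrs H L e.1 ∪ upperNbrs H L e.2 ∪ upperNbrs H L v) c ω
      with hE'
    rcases E'.eq_empty_or_nonempty with h0 | ⟨e, he⟩
    · simp [h0]
    obtain ⟨heE, _, hp⟩ := mem_filter.1 he
    obtain ⟨hu, hw, hne, hnadj⟩ := hE e heE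
    have hku : e.1 ∈ keepers H v c ω := mem_filter.2 ⟨hu, keeps_of_picksExactly hp (by simp)
      (subset_union_left.trans subset_union_left) (by simp [hnadj])⟩
    have hkw : e.2 ∈ keepers H v c ω := mem_filter.2 ⟨hw, keeps_of_picksExactly hp (by simp)
      (subset_union_right.trans subset_union_left) (by simp [hnadj, H.adj_comm e.2])⟩
    have h2 : 2 ≤ (keepers H v c ω).card := by
      rw [← card_pair hne]
      exact card_le_card (insert_subset hku (singleton_subset_iff.2 hkw))
    rw [if_pos (Or.inr ⟨hcv, h2⟩)]
    -- Exactness on the upper neighborhood of `v` leaves one unordered pair for each color, that is,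
    -- two ordered ones. Hence the events can be summed without inclusion–exclusion.
    have hsub : E' ⊆ {(e.1, e.2), (e.2, e.1)} := by
      intro f hf
      obtain ⟨hfE, _, hp'⟩ := mem_filter.1 hf
      obtain ⟨hu', hw', hne', _⟩ := hE f hfE
      have key : ∀ x ∈ upperNbrs H L v, Picks ω c x → x = e.1 ∨ x = e.2 := by
        intro x hx hpx
        by_contra hcon
        exact hp.2 x (mem_union_right _ hx) (by simpa using hcon) hpx
      rcases key f.1 hu' (hp'.1 _ (by simp)) with h3 | h3 <;>
        rcases key f.2 hw' (hp'.1 _ (by simp)) with h4 | h4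
      · exact absurd (h3.trans h4.symm) hne'
      · simp [Prod.ext_iff, h3, h4]
      · simp [Prod.ext_iff, h3, h4]
      · exact absurd (h3.trans h4.symm) hne'
    exact (card_le_card hsub).trans card_le_two
  · have h1 : (E.filter fun e => (c ∈ L e.1 ∧ c ∈ L e.2 ∧ c ∈ L v) ∧
        PicksExactly {e.1, e.2} (upperNbrs H L e.1 ∪ upperNbrs H L e.2 ∪ upperNbrs H L v) c ω) = ∅ := by
      simp [hcv]
    rw [h1, card_empty, add_zero]
    refine Nat.mul_le_mul_left 2 ?_
    set A' := (upperNbrs H L v).filter fun u => (c ∈ L u ∧ c ∉ L v) ∧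
        PicksExactly {u} (upperNbrs H L u ∪ upperNbrs H L v) c ω with hA'
    rcases A'.eq_empty_or_nonempty with h0 | ⟨u, hu⟩
    · simp [h0]
    obtain ⟨huv, _, hp⟩ := mem_filter.1 hu
    have hk : u ∈ keepers H v c ω := mem_filter.2 ⟨huv, keeps_of_picksExactly hp (by simp)
      subset_union_left (by simp)⟩
    rw [if_pos (Or.inl ⟨hcv, card_pos.2 ⟨u, hk⟩⟩)]
    refine card_le_one.2 ?_
    have key : ∀ x ∈ A', x = u := by
      intro x hx
      obtain ⟨hxv, _, hpx⟩ := mem_filter.1 hx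
      by_contra hcon
      exact hp.2 x (mem_union_right _ hxv) (by simpa using hcon) (hpx.1 x (by simp))
    intro a ha b hb
    rw [key a ha, key b hb]

theorem sum_ite_card (X T : Finset C) (hT : T ⊆ X) (P : C → Prop) (hP : ∀ c, c ∈ T ↔ P c) (a : ℝ) :
    ∑ c ∈ X, (if P c then a else 0) = T.card * a := by
  rw [← sum_filter, sum_const, nsmul_eq_mul]
  congr 3
  ext c
  rw [mem_filter, ← hP]
  exact ⟨fun h => h.2, fun h => ⟨hT h, h⟩⟩

/-- The expected savings at `v`. -/
theorem le_expect_gain (hne : ∀ x, (L x).Nonempty)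
    (hdeg : ∀ x, 100 * (univ.filter (H.Adj x)).card ≤ 102 * (L x).card) (v : U)
    (E : Finset (U × U))
    (hE : ∀ e ∈ E, e.1 ∈ upperNbrs H L v ∧ e.2 ∈ upperNbrs H L v ∧ e.1 ≠ e.2 ∧ ¬ H.Adj e.1 e.2) :
    ((lowerNbrs H L v).card : ℝ) / 2 +
      (∑ u ∈ upperNbrs H L v, ((L u \ L v).card : ℝ) * (0.12 / (L u).card)) +
      (∑ e ∈ E, ((L e.1 ∩ L e.2 ∩ L v).card : ℝ) * (0.0147 / ((L e.1).card * (L e.2).card))) ≤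
    𝔼 ω : Tentative L, (gain H v ω : ℝ) := by
  have hnonempty : ∀ x, Nonempty ({c // c ∈ L x} × Bool) := fun x => by
    obtain ⟨c, hc⟩ := hne x
    exact ⟨(⟨c, hc⟩, true)⟩
  have hpos : ∀ x, (1 : ℝ) ≤ (L x).card := fun x => by exact_mod_cast card_pos.2 (hne x)
  have hf0 : ∀ x, 0 ≤ 1 - 1 / (2 * (L x).card : ℝ) := fun x => by
    have := hpos x
    rw [sub_nonneg, div_le_one (by linarith)]; linarith
  have hf1 : ∀ x, 1 - 1 / (2 * (L x).card : ℝ) ≤ 1 := fun x => by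
    have := hpos x
    have : 0 ≤ 1 / (2 * (L x).card : ℝ) := by positivity
    linarith
  have hup := fun u => le_prod_upperNbrs (H := H) hne u (hdeg u)
  set ev1 : C → U → Tentative L → Prop := fun c u ω =>
    PicksExactly {u} (upperNbrs H L u ∪ upperNbrs H L v) c ω with hev1
  set ev2 : C → U × U → Tentative L → Prop := fun c e ω =>
    PicksExactly {e.1, e.2} (upperNbrs H L e.1 ∪ upperNbrs H L e.2 ∪ upperNbrs H L v) c ω with hev2
  have hp1 : ∀ c u, c ∈ L u → 0.12 / (L u).card ≤ 𝔼 ω, (if ev1 c u ω then (1 : ℝ) else 0) := by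
    intro c u hc
    refine le_trans ?_ (le_expect_picksExactly hne {u} _ c (by simpa using hc))
    have h1 := prod_mul_prod_le_prod_union (upperNbrs H L u) (upperNbrs H L v) _ hf0 hf1
    have h2 : (0.49 : ℝ) * 0.49 ≤ _ := (mul_le_mul (hup u) (hup v) (by norm_num)
      (by linarith [hup u])).trans h1
    rw [prod_singleton]
    calc (0.12 : ℝ) / (L u).card ≤ 1 / (2 * (L u).card) * (0.49 * 0.49) := by
          have := hpos u
          rw [div_mul_eq_mul_div, div_le_div_iff₀ (by linarith) (by linarith)]
          nlinarith
      _ ≤ _ := by gcongr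
  -- The probability is at least 0.49³/4 > 0.0294 over the product of the list sizes. Half of it is
  -- credited to each ordered pair.
  have hp2 : ∀ c, ∀ e ∈ E, c ∈ L e.1 → c ∈ L e.2 →
      2 * (0.0147 / ((L e.1).card * (L e.2).card)) ≤
        𝔼 ω, (if ev2 c e ω then (1 : ℝ) else 0) := by
    intro c e he hc1 hc2
    obtain ⟨_, _, hne12, _⟩ := hE e he
    refine le_trans ?_ (le_expect_picksExactly hne {e.1, e.2} _ c
      (by simp [hc1, hc2]))
    have h1 := prod_mul_prod_le_prod_union (upperNbrs H L e.1) (upperNbrs H L e.2) _ hf0 hf1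
    have h2 : (0.49 : ℝ) * 0.49 ≤ _ := (mul_le_mul (hup e.1) (hup e.2) (by norm_num)
      (by linarith [hup e.1])).trans h1
    have h3 := prod_mul_prod_le_prod_union (upperNbrs H L e.1 ∪ upperNbrs H L e.2)
      (upperNbrs H L v) _ hf0 hf1
    have h4 : (0.49 : ℝ) * 0.49 * 0.49 ≤ _ := (mul_le_mul h2 (hup v) (by norm_num)
      (by linarith)).trans h3
    rw [prod_pair hne12]
    have a1 := hpos e.1
    have a2 := hpos e.2
    calc (2 : ℝ) * (0.0147 / ((L e.1).card * (L e.2).card))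
        ≤ 1 / (2 * (L e.1).card) * (1 / (2 * (L e.2).card)) * (0.49 * 0.49 * 0.49) := by
          have a3 : (0 : ℝ) < (L e.1).card * (L e.2).card := by nlinarith
          have : (1 : ℝ) / (2 * (L e.1).card) * (1 / (2 * (L e.2).card)) * (0.49 * 0.49 * 0.49) =
              0.49 * 0.49 * 0.49 / 4 / ((L e.1).card * (L e.2).card) := by
            field_simp; norm_num
          rw [this, ← mul_div_assoc]
          gcongr
          norm_num
      _ ≤ _ := by gcongr
  have hlow : 𝔼 ω : Tentative L, (((lowerNbrs H L v).filter fun u => (ω u).2 = false).card : ℝ) =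
      (lowerNbrs H L v).card / 2 := by
    simp_rw [card_filter]
    push_cast
    rw [expect_sum_comm]
    have : ∀ u, 𝔼 ω : Tentative L, (if (ω u).2 = false then (1 : ℝ) else 0) = 1 / 2 := by
      intro u
      rw [← expect_update u]
      simp only [Function.update_self, Fintype.expect_const]
      rw [← univ_product_univ, expect_product]
      have hb : 𝔼 b : Bool, (if b = false then (1 : ℝ) else 0) = 1 / 2 := by
        rw [Fintype.expect_eq_sum_div_card]; simp
      simp only [hb]
      have : Nonempty {c // c ∈ L u} := (hnonempty u).map Prod.fst
      rw [Fintype.expect_const]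
    simp_rw [this]
    rw [sum_const, nsmul_eq_mul]; ring
  set X : Finset C := univ.biUnion L with hX
  have hLX : ∀ u, L u ⊆ X := fun u => subset_biUnion_of_mem L (mem_univ u)
  have hpt : ∀ ω : Tentative L,
      (∑ c ∈ X, ∑ u ∈ upperNbrs H L v, (if c ∈ L u ∧ c ∉ L v then
          (if ev1 c u ω then (1 : ℝ) else 0) else 0)) +
        (∑ c ∈ X, ∑ e ∈ E, (if c ∈ L e.1 ∧ c ∈ L e.2 ∧ c ∈ L v then
          (if ev2 c e ω then (1 : ℝ) else 0) else 0)) / 2 ≤ (savedColors H v ω).card := by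
    intro ω
    rw [savedColors, card_filter]
    push_cast
    rw [sum_div, ← sum_add_distrib]
    refine sum_le_sum fun c _ => ?_
    have := card_picksExactly_le v E hE ω c
    rw [card_filter, card_filter] at this
    have h' : (2 : ℝ) * (∑ u ∈ upperNbrs H L v, (if (c ∈ L u ∧ c ∉ L v) ∧ ev1 c u ω
        then (1 : ℝ) else 0)) +
        (∑ e ∈ E, (if (c ∈ L e.1 ∧ c ∈ L e.2 ∧ c ∈ L v) ∧ ev2 c e ω then (1 : ℝ) else 0)) ≤
        2 * (if (c ∉ L v ∧ 1 ≤ (keepers H v c ω).card) ∨ (c ∈ L v ∧ 2 ≤ (keepers H v c ω).card)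
        then (1 : ℝ) else 0) := by
      have h := (Nat.cast_le (α := ℝ)).2 this
      push_cast at h
      exact h
    simp_rw [ite_and] at h' ⊢
    linarith
  have hsaved : (∑ u ∈ upperNbrs H L v, ((L u \ L v).card : ℝ) * (0.12 / (L u).card)) +
      (∑ e ∈ E, ((L e.1 ∩ L e.2 ∩ L v).card : ℝ) * (0.0147 / ((L e.1).card * (L e.2).card))) ≤
      𝔼 ω : Tentative L, ((savedColors H v ω).card : ℝ) := by
    refine le_trans ?_ (expect_le_expect fun ω _ => hpt ω)
    rw [expect_add_distrib, ← expect_div, expect_sum_comm, expect_sum_comm]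
    simp_rw [expect_sum_comm]
    rw [sum_comm, sum_comm (s := X) (t := E), sum_div]
    refine add_le_add (sum_le_sum fun u _ => ?_) (sum_le_sum fun e he => ?_)
    · rw [← sum_ite_card X (L u \ L v) (sdiff_subset.trans (hLX u))
        (fun c => c ∈ L u ∧ c ∉ L v) (fun c => mem_sdiff)]
      refine sum_le_sum fun c _ => ?_
      by_cases h : c ∈ L u ∧ c ∉ L v
      · simp only [h, not_false_eq_true, and_self, if_true]
        exact hp1 c u h.1
      · simp [h]
    · rw [← sum_ite_card X (L e.1 ∩ L e.2 ∩ L v) (inter_subset_right.trans (hLX v))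
        (fun c => c ∈ L e.1 ∧ c ∈ L e.2 ∧ c ∈ L v) (fun c => by simp), sum_div]
      refine sum_le_sum fun c _ => ?_
      by_cases h : c ∈ L e.1 ∧ c ∈ L e.2 ∧ c ∈ L v
      · simp only [h, and_self, if_true]
        linarith [hp2 c e he h.1 h.2.1]
      · simp [h]
  have : 𝔼 ω : Tentative L, (gain H v ω : ℝ) = (lowerNbrs H L v).card / 2 +
      𝔼 ω : Tentative L, ((savedColors H v ω).card : ℝ) := by
    rw [← hlow, ← expect_add_distrib]
    refine expect_congr rfl fun ω _ => ?_
    rw [gain]; push_cast; rfl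
  rw [this]
  linarith

end ExpectedGain

/-! ### Small expected savings force a colorable dense neighborhood. -/

section Core

open scoped Classical

variable {U C : Type*} {H : SimpleGraph U}

/-- Here l ≤ a, b ≤ 10l/9, and inclusion–exclusion gives N ≥ 0.9a + 0.9b − l. On that range this is
at least 0.8ab/l, and 0.01176 = 0.8 · 0.0147. -/
theorem inter_card_lower_bound {l a b x y N : ℝ} (hl : 0 < l) (hla : l ≤ a) (hlb : l ≤ b)
    (hx : 10 * x ≤ a) (hy : 10 * y ≤ b) (hax : a ≤ l + x) (hbl : b ≤ l + y)
    (hN : (a - x) + (b - y) ≤ N + l) : 0.01176 / l ≤ N * (0.0147 / (a * b)) := by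
  have ha : 0 < a := by linarith
  have hb : 0 < b := by linarith
  rw [mul_div_assoc', div_le_div_iff₀ hl (by positivity)]
  have ha9 : 0 ≤ l / 9 - (a - l) := by linarith only [hx, hax]
  have hb9 : 0 ≤ l / 9 - (b - l) := by linarith only [hy, hbl]
  have h1 : 0.8 * (a * b) ≤ (0.9 * a + 0.9 * b - l) * l := by
    nlinarith [mul_nonneg (sub_nonneg.2 hla) hb9, mul_nonneg (sub_nonneg.2 hlb) ha9]
  have h2 : (0.9 * a + 0.9 * b - l) * l ≤ N * l := by
    apply mul_le_mul_of_nonneg_right _ hl.le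
    linarith
  nlinarith

theorem card_filter_mul_le_sum (s : Finset U) (f : U → ℝ) (hf : ∀ x ∈ s, 0 ≤ f x) (P : U → Prop)
    [DecidablePred P] (a : ℝ) (hP : ∀ x ∈ s, P x → a ≤ f x) : ((s.filter P).card : ℝ) * a ≤ ∑ x ∈ s, f x := by
  calc ((s.filter P).card : ℝ) * a = ∑ x ∈ s.filter P, a := by rw [sum_const, nsmul_eq_mul]
    _ ≤ ∑ x ∈ s.filter P, f x :=
      sum_le_sum fun x hx => hP x (mem_filter.1 hx).1 (mem_filter.1 hx).2
    _ ≤ _ := sum_le_sum_of_subset_of_nonneg (filter_subset _ _) fun x hx _ => hf x hx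

variable [Fintype U]

set_option maxHeartbeats 1600000 in
/-- If every nonempty induced subgraph is uncolorable from some lists that are short of the
degrees by at most `s`, then the expected savings are large at every vertex. -/
theorem le_expect_gain_of_critical (L : U → Finset C) (s : U → ℕ) (Om : ℝ) (hOm : 0 ≤ Om)
    (hL : ∀ x, (L x).card + s x = (univ.filter (H.Adj x)).card)
    (hs : ∀ x, Om + 2600 * s x + 1000 ≤ (univ.filter (H.Adj x)).card)
    (hcl : ∀ T : Finset U, H.IsClique (T : Set U) → (T.card : ℝ) ≤ Om)
    (hcrit : ∀ X : Finset U, X.Nonempty → ∃ L' : U → Finset C,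
      (∀ u ∈ X, (X.filter (H.Adj u)).card ≤ (L' u).card + s u) ∧ ¬ H.ListColorableOn X L')
    (v : U) : (((univ.filter (H.Adj v)).card : ℝ) - Om) / 2500 ≤
      𝔼 ω : Tentative L, (gain H v ω : ℝ) := by
  by_contra! hcon
  have hLr : ∀ x, ((L x).card : ℝ) + s x = (univ.filter (H.Adj x)).card := fun x => by
    exact_mod_cast hL x
  have hpos : ∀ x, (1 : ℝ) ≤ (L x).card := fun x => by
    have := hLr x; have := hs x
    have : (0 : ℝ) ≤ s x := Nat.cast_nonneg _
    linarith
  have hne : ∀ x, (L x).Nonempty := fun x => card_pos.1 (by exact_mod_cast hpos x)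
  obtain ⟨c0, _⟩ := hne v
  have : Nonempty C := ⟨c0⟩
  have hdeg : ∀ x, 100 * (univ.filter (H.Adj x)).card ≤ 102 * (L x).card := fun x => by
    have h1 := hLr x; have h2 := hs x
    have h3 : (0 : ℝ) ≤ s x := Nat.cast_nonneg _
    have : (100 : ℝ) * (univ.filter (H.Adj x)).card ≤ 102 * (L x).card := by linarith
    exact_mod_cast this
  set d : ℝ := ((univ.filter (H.Adj v)).card : ℝ) with hd
  set g : ℝ := d - Om with hg
  set l : ℝ := ((L v).card : ℝ) with hl
  have hl1 : 1 ≤ l := hpos v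
  have hld : l ≤ d := by
    have := hLr v
    have : (0 : ℝ) ≤ s v := Nat.cast_nonneg _
    linarith
  have hg1000 : 1000 ≤ g := by
    have := hs v
    have : (0 : ℝ) ≤ s v := Nat.cast_nonneg _
    linarith
  have hgd : g ≤ d := by linarith
  have hd0 : 0 < d := by linarith
  have hsd : ∀ u u', ((L u).card : ℝ) ≤ (L u').card + (L u \ L u').card := fun u u' => by
    have := card_le_card_sdiff_add_card (s := L u) (t := L u')
    exact_mod_cast (by omega : (L u).card ≤ (L u').card + (L u \ L u').card)
  -- Neighbors whose list lies mostly inside L(v), so that any two of them share most of their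
  -- colors. At most 10 · g/300 = g/30 upper neighbors are lost.
  set Q : Finset U := (upperNbrs H L v).filter fun u => 10 * (L u \ L v).card ≤ (L u).card with hQ
  have hQup : Q ⊆ upperNbrs H L v := filter_subset _ _
  have hQ10 : ∀ u ∈ Q, (10 : ℝ) * (L u \ L v).card ≤ (L u).card := fun u hu => by
    exact_mod_cast (mem_filter.1 hu).2
  have hQl : ∀ u ∈ Q, l ≤ (L u).card := fun u hu =>
    Nat.cast_le.2 (mem_filter.1 (hQup hu)).2.2
  set E : Finset (U × U) := (Q ×ˢ Q).filter fun e => e.1 ≠ e.2 ∧ ¬ H.Adj e.1 e.2 with hE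
  have hEmem : ∀ e ∈ E, e.1 ∈ Q ∧ e.2 ∈ Q ∧ e.1 ≠ e.2 ∧ ¬ H.Adj e.1 e.2 := by
    intro e he
    obtain ⟨h1, h2⟩ := mem_filter.1 he
    exact ⟨(mem_product.1 h1).1, (mem_product.1 h1).2, h2⟩
  have hgain := le_expect_gain hne hdeg v E fun e he =>
    ⟨hQup (hEmem e he).1, hQup (hEmem e he).2.1, (hEmem e he).2.2⟩
  set out : U → ℝ := fun u => ((L u \ L v).card : ℝ) / (L u).card with hout
  have hout0 : ∀ u, 0 ≤ out u := fun u => by positivity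
  have hsum1 : ∑ u ∈ upperNbrs H L v, ((L u \ L v).card : ℝ) * (0.12 / (L u).card) =
      0.12 * ∑ u ∈ upperNbrs H L v, out u := by
    rw [mul_sum]
    refine sum_congr rfl fun u _ => ?_
    rw [hout]; ring
  have hsum2 : (E.card : ℝ) * (0.01176 / l) ≤
      ∑ e ∈ E, ((L e.1 ∩ L e.2 ∩ L v).card : ℝ) * (0.0147 / ((L e.1).card * (L e.2).card)) := by
    rw [← nsmul_eq_mul, ← sum_const]
    refine sum_le_sum fun e he => ?_
    obtain ⟨h1, h2, _⟩ := hEmem e he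
    refine inter_card_lower_bound (x := (L e.1 \ L v).card) (y := (L e.2 \ L v).card)
      (by linarith) (hQl _ h1) (hQl _ h2) (hQ10 _ h1) (hQ10 _ h2) (hsd _ _) (hsd _ _) ?_
    have e1 := card_inter_add_card_sdiff (L e.1) (L v)
    have e2 := card_inter_add_card_sdiff (L e.2) (L v)
    have e3 := card_union_add_card_inter (L e.1 ∩ L v) (L e.2 ∩ L v)
    have e4 := card_le_card (union_subset (inter_subset_right (s₁ := L e.1) (s₂ := L v))
      (inter_subset_right (s₁ := L e.2) (s₂ := L v)))
    rw [← inter_inter_distrib_right] at e3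
    have e5 : (L e.1).card + (L e.2).card ≤ (L e.1 ∩ L e.2 ∩ L v).card + (L v).card +
        (L e.1 \ L v).card + (L e.2 \ L v).card := by omega
    have e6 : ((L e.1).card : ℝ) + (L e.2).card ≤ (L e.1 ∩ L e.2 ∩ L v).card + (L v).card +
        (L e.1 \ L v).card + (L e.2 \ L v).card := by exact_mod_cast e5
    linarith
  rw [hsum1] at hgain
  have hS0 : 0 ≤ ∑ u ∈ upperNbrs H L v, out u := sum_nonneg fun u _ => hout0 u
  have hE0 : 0 ≤ (E.card : ℝ) * (0.01176 / l) := by positivity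
  have hLo0 : (0 : ℝ) ≤ (lowerNbrs H L v).card := Nat.cast_nonneg _
  have hLo : ((lowerNbrs H L v).card : ℝ) ≤ g / 1250 := by linarith
  have hSout : ∑ u ∈ upperNbrs H L v, out u ≤ g / 300 := by linarith
  have hEcard : (E.card : ℝ) ≤ g * d / 29 := by
    have h1 : (E.card : ℝ) * (0.01176 / l) ≤ g / 2500 := by linarith
    rw [mul_div_assoc', div_le_iff₀ (by linarith)] at h1
    linarith [mul_le_mul_of_nonneg_left hld (by linarith : (0 : ℝ) ≤ g),
      mul_nonneg (by linarith : (0 : ℝ) ≤ g) hd0.le]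
  have hdrop : ((upperNbrs H L v).card : ℝ) ≤ Q.card + g / 30 := by
    have h1 := card_filter_mul_le_sum (upperNbrs H L v) out (fun u _ => hout0 u)
      (fun u => ¬ 10 * (L u \ L v).card ≤ (L u).card) (1 / 10) (by
        intro u _ hu
        have : ((L u).card : ℝ) < 10 * (L u \ L v).card := by exact_mod_cast not_le.1 hu
        rw [hout]
        simp only
        rw [div_le_div_iff₀ (by norm_num) (by linarith [hpos u])]
        linarith)
    have h2 := card_filter_add_card_filter_not (s := upperNbrs H L v)
      fun u => 10 * (L u \ L v).card ≤ (L u).card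
    have h3 : (Q.card : ℝ) + ((upperNbrs H L v).filter
        fun u => ¬ 10 * (L u \ L v).card ≤ (L u).card).card = (upperNbrs H L v).card := by
      exact_mod_cast h2
    linarith
  have hdsum : d = (lowerNbrs H L v).card + (upperNbrs H L v).card := by
    rw [hd, card_nbrs_eq (L := L)]; push_cast; rfl
  set nn : U → Finset U := fun u => Q.filter fun w => u ≠ w ∧ ¬ H.Adj u w with hnn
  have hnnE : ∑ u ∈ Q, ((nn u).card : ℝ) = E.card := by
    rw [hE, card_filter, sum_product]
    push_cast
    refine sum_congr rfl fun u _ => ?_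
    rw [hnn]; simp only [card_filter]; push_cast; rfl
  -- Vertices with at least d/5 non-neighbors in `Q` are removed so that the remaining lists stay
  -- above 0.58d. In all at most g/1250 + g/30 + 5g/29 ≤ 0.21g neighbors are discarded.
  set VB : Finset U := Q.filter fun u => d ≤ 5 * (nn u).card with hVB
  have hVBcard : (VB.card : ℝ) ≤ 5 * g / 29 := by
    have h1 := card_filter_mul_le_sum Q (fun u => ((nn u).card : ℝ))
      (fun u _ => Nat.cast_nonneg _) (fun u => d ≤ 5 * (nn u).card) (d / 5)
      (fun u _ h => by linarith)
    rw [hnnE] at h1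
    have h2 : (VB.card : ℝ) * (d / 5) ≤ 5 * g / 29 * (d / 5) := by
      refine h1.trans (hEcard.trans (le_of_eq ?_)); ring
    exact le_of_mul_le_mul_right h2 (by positivity)
  set X : Finset U := Q \ VB with hX
  have hXQ : X ⊆ Q := sdiff_subset
  have hXcard : d - 0.21 * g ≤ X.card := by
    have h0 : X.card + VB.card = Q.card := card_sdiff_add_card_eq_card (filter_subset _ _)
    have h1 : (X.card : ℝ) + VB.card = Q.card := by exact_mod_cast h0
    linarith
  have hXd : (X.card : ℝ) ≤ d := by
    have h1 : (X.card : ℝ) ≤ (upperNbrs H L v).card := by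
      exact_mod_cast card_le_card (hXQ.trans hQup)
    linarith
  have hXnn : ∀ u ∈ X, 5 * ((nn u).card : ℝ) < d := by
    intro u hu
    by_contra! h
    exact (mem_sdiff.1 hu).2 (mem_filter.2 ⟨hXQ hu, h⟩)
  have hsu : ∀ u ∈ X, (s u : ℝ) ≤ 0.001 * d := by
    intro u hu
    have h1 := hs u; have h2 := hLr u; have h3 := hQ10 u (hXQ hu); have h4 := hsd u v
    linarith
  set Bad : Finset U := (X.filter fun u => 0.12 * g ≤ (nn u).card) ∪
    X.filter fun u => 0.005 * g ≤ s u with hBad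
  have hBadcard : (Bad.card : ℝ) ≤ 0.288 * d := by
    have h0 : (Bad.card : ℝ) ≤ (X.filter fun u => 0.12 * g ≤ (nn u).card).card +
        (X.filter fun u => 0.005 * g ≤ s u).card := by exact_mod_cast card_union_le _ _
    have h1 := card_filter_mul_le_sum X (fun u => ((nn u).card : ℝ))
      (fun u _ => Nat.cast_nonneg _) (fun u => 0.12 * g ≤ (nn u).card) (0.12 * g)
      (fun u _ h => h)
    have h2 : ∑ u ∈ X, ((nn u).card : ℝ) ≤ E.card := by
      rw [← hnnE]
      exact sum_le_sum_of_subset_of_nonneg hXQ fun u _ _ => Nat.cast_nonneg _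
    have h3 : ((X.filter fun u => 0.12 * g ≤ (nn u).card).card : ℝ) ≤ 0.2875 * d := by
      have : ((X.filter fun u => 0.12 * g ≤ (nn u).card).card : ℝ) * (0.12 * g) ≤
          0.2875 * d * (0.12 * g) := by
        linarith [mul_pos hd0 (by linarith : 0 < g)]
      exact le_of_mul_le_mul_right this (by linarith)
    -- This is what 2600 s buys: excess at least 0.005g makes |L(u)| exceed |L(v)| by at least 11g.
    -- So at least a 9g/d fraction of L(u) is useless at `v`, which the bound g/300 on the sum of
    -- `out` allows only rarely.
    have h4 := card_filter_mul_le_sum X out (fun u _ => hout0 u)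
      (fun u => 0.005 * g ≤ s u) (9 * g / d) (by
        intro u hu h
        have a1 := hs u; have a2 := hLr u; have a3 := hQ10 u (hXQ hu); have a4 := hsd u v
        rw [hout]
        simp only
        have a5 : 11 * g ≤ (L u \ L v).card := by linarith
        have a6 : ((L u).card : ℝ) ≤ 11 / 9 * d := by linarith
        rw [div_le_div_iff₀ hd0 (by linarith [hpos u])]
        linarith [mul_le_mul_of_nonneg_left a6 (by linarith : 0 ≤ 9 * g),
          mul_le_mul_of_nonneg_right a5 hd0.le])
    have h5 : ∑ u ∈ X, out u ≤ g / 300 :=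
      (sum_le_sum_of_subset_of_nonneg (hXQ.trans hQup) fun u _ _ => hout0 u).trans hSout
    have h6 : ((X.filter fun u => 0.005 * g ≤ s u).card : ℝ) ≤ 0.0005 * d := by
      have h7 := h4.trans h5
      rw [mul_div_assoc', div_le_iff₀ hd0] at h7
      have : ((X.filter fun u => 0.005 * g ≤ s u).card : ℝ) * g ≤ 0.0005 * d * g := by
        linarith [mul_pos hd0 (by linarith : 0 < g)]
      exact le_of_mul_le_mul_right this (by linarith)
    linarith
  have hXne : X.Nonempty := card_pos.1 (by
    have : (0 : ℝ) < X.card := by linarith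
    exact_mod_cast this)
  obtain ⟨L', hL', hnc⟩ := hcrit X hXne
  have hlist : ∀ u ∈ X, (X.card : ℝ) ≤ (L' u).card + s u + 1 + (nn u).card := by
    intro u hu
    have h1 : X ⊆ insert u (X.filter (H.Adj u) ∪ nn u) := by
      intro w hw
      by_cases e : w = u
      · simp [e]
      · refine mem_insert_of_mem ?_
        by_cases hadj : H.Adj u w
        · exact mem_union_left _ (mem_filter.2 ⟨hw, hadj⟩)
        · exact mem_union_right _ (mem_filter.2 ⟨hXQ hw, Ne.symm e, hadj⟩)
    have h2 := (card_le_card h1).trans ((card_insert_le _ _).trans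
      (Nat.add_le_add_right (card_union_le _ _) 1))
    have h3 := hL' u hu
    exact_mod_cast (by omega : X.card ≤ (L' u).card + s u + 1 + (nn u).card)
  -- `m` covers 0.12g non-neighbors, excess 0.005g and the vertex itself, with g ≥ 1000 absorbing
  -- rounding. Cliques fit because Om + 0.39g + 3 ≤ d − 0.21g.
  refine hnc (ListColorableOn.of_dense H X Bad L' ⌈0.13 * g⌉₊ ⌊0.58 * d⌋₊ ?_ ?_ ?_ ?_ ?_)
  all_goals
    have hm1 := Nat.le_ceil (0.13 * g)
    have hm2 := Nat.ceil_lt_add_one (by linarith : 0 ≤ 0.13 * g)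
    have hr1 := Nat.floor_le (by linarith : 0 ≤ 0.58 * d)
    have hr2 := Nat.lt_floor_add_one (0.58 * d)
  · intro u hu
    have h1 := hlist u hu; have h2 := hXnn u hu; have h3 := hsu u hu
    have : ((⌊0.58 * d⌋₊ : ℕ) : ℝ) ≤ (L' u).card := by linarith
    exact_mod_cast this
  · intro u hu huB
    have h1 := hlist u hu
    have h2 : ((nn u).card : ℝ) < 0.12 * g := by
      by_contra! h
      exact huB (mem_union_left _ (mem_filter.2 ⟨hu, h⟩))
    have h3 : (s u : ℝ) < 0.005 * g := by
      by_contra! h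
      exact huB (mem_union_right _ (mem_filter.2 ⟨hu, h⟩))
    have : (X.card : ℝ) ≤ (L' u).card + (⌈0.13 * g⌉₊ : ℕ) := by linarith
    exact_mod_cast this
  · have : (Bad.card : ℝ) + (⌈0.13 * g⌉₊ : ℕ) ≤ (⌊0.58 * d⌋₊ : ℕ) := by linarith
    exact_mod_cast this
  · have : (X.card : ℝ) + (⌈0.13 * g⌉₊ : ℕ) ≤ 2 * (⌊0.58 * d⌋₊ : ℕ) := by linarith
    exact_mod_cast this
  · intro T _ hT
    have h1 := hcl T hT
    have : (T.card : ℝ) + 3 * (⌈0.13 * g⌉₊ : ℕ) ≤ X.card := by linarith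
    exact_mod_cast this

/-- No graph without large cliques has all its induced subgraphs uncolorable from lists that are
only slightly shorter than the degrees. -/
theorem not_critical_of_nearly_degree_lists [Nonempty U] (s : U → ℕ) (Om η k : ℝ) (hOm : 0 ≤ Om)
    (hη : 0 < η) (hη1 : η ≤ 1) (hηk : 1000 ≤ η * k)
    (hk : 1024 * k ^ 4 * Real.exp (-(6e-13 * η ^ 3) * k) ≤ 1)
    (hs : ∀ x, Om + η * k + 2600 * s x ≤ (univ.filter (H.Adj x)).card)
    (hD : ∀ x, ((univ.filter (H.Adj x)).card : ℝ) ≤ 2 * k)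
    (hcl : ∀ T : Finset U, H.IsClique (T : Set U) → (T.card : ℝ) ≤ Om)
    (hcrit : ∀ X : Finset U, X.Nonempty → ∃ L' : U → Finset C,
      (∀ u ∈ X, (X.filter (H.Adj u)).card ≤ (L' u).card + s u) ∧ ¬ H.ListColorableOn X L') :
    False := by
  obtain ⟨L0, hL0, hnc⟩ := hcrit univ univ_nonempty
  have hs0 : ∀ x, (0 : ℝ) ≤ s x := fun x => Nat.cast_nonneg _
  have hsle : ∀ x, s x ≤ (univ.filter (H.Adj x)).card := fun x => by
    have h1 := hs x; have h2 := hs0 x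
    have : (s x : ℝ) ≤ (univ.filter (H.Adj x)).card := by linarith
    exact_mod_cast this
  have hex : ∀ x, ∃ t ⊆ L0 x, t.card = (univ.filter (H.Adj x)).card - s x := fun x =>
    exists_subset_card_eq (by have := hL0 x (mem_univ x); omega)
  choose L hLsub hLcard using hex
  have hL : ∀ x, (L x).card + s x = (univ.filter (H.Adj x)).card := fun x => by
    have := hLcard x; have := hsle x; omega
  have hLr : ∀ x, ((L x).card : ℝ) + s x = (univ.filter (H.Adj x)).card := fun x => by
    exact_mod_cast hL x
  have hkpos : 0 < k := by nlinarith
  have hk1 : 1000 ≤ k := by nlinarith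
  have hq : ∀ x, η * k / 2 ≤ (L x).card := fun x => by
    have h1 := hs x; have h2 := hLr x; have h3 := hs0 x
    linarith
  have hne : ∀ x, (L x).Nonempty := fun x => card_pos.1 (by
    have : (0 : ℝ) < (L x).card := by linarith [hq x]
    exact_mod_cast this)
  have hE := le_expect_gain_of_critical L s Om hOm hL (fun x => by linarith [hs x]) hcl hcrit
  -- The variance term D + D²/q is 2k + 8k/η, so l of order η² makes l·t, of order η³k, dominate
  -- 9l²(D + D²/q). The net exponent is at most −6e-13 η³k.
  obtain ⟨ω, hω⟩ := exists_gain (H := H) hne s (l := 1e-7 * η ^ 2) (q := η * k / 2) (D := 2 * k)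
    (t := η * k / 65000) (by positivity) (by nlinarith) (by positivity) hq (by linarith) hD
    (fun v => by
      have h1 := hE v; have h2 := hs v; have h3 := hs0 v
      linarith)
    (by
      refine le_trans ?_ hk
      have hexp : -(1e-7 * η ^ 2) * (η * k / 65000) +
          9 * (1e-7 * η ^ 2) ^ 2 * (2 * k + (2 * k) ^ 2 / (η * k / 2)) ≤
          -(6e-13 * η ^ 3) * k := by
        have e1 : (2 * k) ^ 2 / (η * k / 2) = 8 * k / η := by field_simp; ring
        have e2 : (η ^ 2) ^ 2 * (8 * k / η) = 8 * (η ^ 3 * k) := by field_simp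
        have e3 : η ^ 4 * k ≤ η ^ 3 * k := by
          have : η ^ 4 ≤ η ^ 3 := pow_le_pow_of_le_one hη.le hη1 (by norm_num)
          gcongr
        have e4 : 0 ≤ η ^ 3 * k := by positivity
        rw [e1]
        have e5 : -(1e-7 * η ^ 2) * (η * k / 65000) +
            9 * (1e-7 * η ^ 2) ^ 2 * (2 * k + 8 * k / η) =
            -(1e-7 / 65000) * (η ^ 3 * k) + 18e-14 * (η ^ 4 * k) +
              9e-14 * ((η ^ 2) ^ 2 * (8 * k / η)) := by ring
        rw [e5, e2]
        nlinarith
      have := Real.exp_le_exp.2 hexp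
      have e6 : 64 * (2 * k) ^ 4 = 1024 * k ^ 4 := by ring
      rw [e6]
      gcongr)
  obtain ⟨φ, hφ, hφ'⟩ := ListColorableOn.of_gain ω s (fun v => (hL v).ge) hω
  exact hnc ⟨φ, fun v hv => hLsub v (hφ v hv), hφ'⟩

end Core

/-! ### From a critical graph of small average degree to the core statement. -/

section Reduction

open scoped Classical

variable {V C : Type*} [Fintype V] {G : SimpleGraph V}

/-- A graph with enough edges has an induced subgraph of large minimum degree, relative to a
weight on the vertices. -/
theorem exists_induced_minDegree (thr : V → ℝ)
    (h : 2 * ∑ v, thr v < ∑ v, ((univ.filter (G.Adj v)).card : ℝ)) :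
    ∃ W : Finset V, W.Nonempty ∧ ∀ v ∈ W, thr v ≤ (W.filter (G.Adj v)).card := by
  -- Edges count twice in `f`, hence the doubled weights: deleting `v` changes `f` by 2(thr v −
  -- deg_W v), which is not positive at a maximizer. Positivity at `univ` rules out the empty
  -- maximizer.
  set f : Finset V → ℝ := fun W =>
    (∑ v ∈ W, ((W.filter (G.Adj v)).card : ℝ)) - 2 * ∑ v ∈ W, thr v with hf
  obtain ⟨W, -, hmax⟩ := exists_max_image (univ : Finset (Finset V)) f univ_nonempty
  have hpos : 0 < f W := lt_of_lt_of_le (by rw [hf]; simpa using h) (hmax univ (mem_univ _))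
  refine ⟨W, ?_, fun v hv => ?_⟩
  · rw [nonempty_iff_ne_empty]
    rintro rfl
    simp [hf] at hpos
  · have h1 := hmax (W.erase v) (mem_univ _)
    have h2 : ∑ u ∈ W, thr u = thr v + ∑ u ∈ W.erase v, thr u := (add_sum_erase W thr hv).symm
    have h3 : ∑ u ∈ W, ((W.filter (G.Adj u)).card : ℝ) = (W.filter (G.Adj v)).card +
        ∑ u ∈ W.erase v, ((W.filter (G.Adj u)).card : ℝ) :=
      (add_sum_erase W (fun u => ((W.filter (G.Adj u)).card : ℝ)) hv).symm
    have h4 : ∑ u ∈ W.erase v, ((W.filter (G.Adj u)).card : ℝ) =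
        (∑ u ∈ W.erase v, (((W.erase v).filter (G.Adj u)).card : ℝ)) +
          ∑ u ∈ W.erase v, (if G.Adj v u then (1 : ℝ) else 0) := by
      rw [← sum_add_distrib]
      refine sum_congr rfl fun u _ => ?_
      rw [filter_erase]
      by_cases hvu : G.Adj v u
      · have : v ∈ W.filter (G.Adj u) := mem_filter.2 ⟨hv, hvu.symm⟩
        rw [if_pos hvu]
        exact_mod_cast (card_erase_add_one this).symm
      · have : v ∉ W.filter (G.Adj u) := fun h' => hvu (mem_filter.1 h').2.symm
        rw [if_neg hvu, erase_eq_of_notMem this, add_zero]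
    have h5 : ∑ u ∈ W.erase v, (if G.Adj v u then (1 : ℝ) else 0) = (W.filter (G.Adj v)).card := by
      rw [sum_boole, filter_erase, erase_eq_of_notMem]
      simp
    simp only [hf] at h1
    rw [h2, h3, h4, h5] at h1
    linarith

/-- In a critical graph, coloring the complement of `X` leaves lists from which `X` is not
colorable. -/
theorem IsListCritical.exists_not_listColorableOn {L : V → Set C} {k : ℕ}
    (hL : IsListAssignment k L) (hG : G.IsListCritical L) (X : Finset V) (hX : X.Nonempty) :
    ∃ L' : V → Finset C, (∀ u ∈ X, (X.filter (G.Adj u)).card + k ≤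
      (L' u).card + (univ.filter (G.Adj u)).card) ∧ ¬ G.ListColorableOn X L' := by
  obtain ⟨x0, hx0⟩ := hX
  obtain ⟨c0, _⟩ := (hL x0).1
  obtain ⟨φ, hφ⟩ := hG.2 {x | x ∉ X} fun h => by
    have : x0 ∈ {x | x ∉ X} := h ▸ Set.mem_univ x0
    exact this hx0
  set ψ : V → C := fun x => if h : x ∉ X then φ ⟨x, h⟩ else c0 with hψ
  have hψout : ∀ x (h : x ∉ X), ψ x = φ ⟨x, h⟩ := fun x h => dif_pos h
  set F : V → Finset C := fun u => ((univ \ X).filter (G.Adj u)).image ψ with hF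
  have hcard : ∀ u, (X.filter (G.Adj u)).card + ((univ \ X).filter (G.Adj u)).card =
      (univ.filter (G.Adj u)).card := by
    intro u
    rw [← card_union_of_disjoint, ← filter_union, union_sdiff_of_subset (subset_univ X)]
    exact disjoint_filter_filter disjoint_sdiff
  -- The original lists may be infinite, so a finite sublist of the surviving colors is extracted.
  have hex : ∀ u, ∃ t : Finset C, (t : Set C) ⊆ L u \ F u ∧ k ≤ t.card + (F u).card := by
    intro u
    have h1 : ((k - (F u).card : ℕ) : ℕ∞) ≤ (L u \ F u).encard := by
      have h2 := Set.encard_le_encard_sdiff_add_encard (L u) (F u : Set C)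
      rw [Set.encard_coe_eq_coe_finsetCard] at h2
      have h3 := (hL u).2.trans h2
      push_cast
      exact tsub_le_iff_right.2 h3
    obtain ⟨t, ht, htc⟩ := Set.exists_subset_encard_eq h1
    have hfin : t.Finite := Set.finite_of_encard_eq_coe htc
    refine ⟨hfin.toFinset, by simpa using ht, ?_⟩
    rw [hfin.encard_eq_coe_toFinset_card] at htc
    have : hfin.toFinset.card = k - (F u).card := by exact_mod_cast htc
    omega
  choose L' hL' hL'c using hex
  refine ⟨L', fun u _ => ?_, ?_⟩
  · have h1 := hL'c u
    have h2 : (F u).card ≤ ((univ \ X).filter (G.Adj u)).card := card_image_le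
    have h3 := hcard u
    omega
  · rintro ⟨χ, hχL, hχ⟩
    have cross : ∀ a ∈ X, ∀ b ∉ X, G.Adj a b → χ a ≠ ψ b := by
      intro a ha b hb hab e
      refine (hL' a (hχL a ha)).2 ?_
      rw [e]
      exact mem_image_of_mem ψ (mem_filter.2 ⟨by simp [hb], hab⟩)
    refine hG.1 ⟨Coloring.mk (fun x => if x ∈ X then χ x else ψ x) ?_, ?_⟩
    · intro a b hab
      by_cases ha : a ∈ X <;> by_cases hb : b ∈ X <;> simp only [ha, hb, if_true, if_false]
      · exact hχ a ha b hb hab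
      · exact cross a ha b hb hab
      · exact (cross b hb a ha hab.symm).symm
      · rw [hψout a ha, hψout b hb]
        exact φ.valid hab
    · intro x
      change (if x ∈ X then χ x else ψ x) ∈ L x
      split_ifs with hx
      · exact (hL' x (hχL x hx)).1
      · rw [hψout x hx]
        exact hφ ⟨x, hx⟩

theorem IsListCritical.le_degree {L : V → Set C} {k : ℕ} (hL : IsListAssignment k L)
    (hG : G.IsListCritical L) (v : V) : k ≤ (univ.filter (G.Adj v)).card := by
  by_contra! hlt
  obtain ⟨L', h1, h2⟩ := hG.exists_not_listColorableOn hL {v} (singleton_nonempty v)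
  have h3 := h1 v (mem_singleton_self v)
  obtain ⟨c, hc⟩ : (L' v).Nonempty := card_pos.1 (by omega)
  exact h2 ⟨fun _ => c, by simpa using hc, by simp⟩

/-- A critical graph without large cliques whose average degree is close to `k` does not exist,
once `k` is large. -/
theorem IsListCritical.lt_sum_degree_of_large {L : V → Set C} {k : ℕ}
    {α : ℝ} (hα : 0 < α) (hα2 : α < 1 / 2) (hηk : 1000 ≤ α / 100 * k)
    (hk : 1024 * (k : ℝ) ^ 4 * Real.exp (-(6e-13 * (α / 100) ^ 3) * k) ≤ 1)
    (hL : IsListAssignment k L) (hG : G.IsListCritical L)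
    (hω : (G.cliqueNum : ℝ) < (1 / 2 - α) * k) :
    (1 + α ^ 2 / 1350) * (k : ℝ) * Fintype.card V <
      ∑ v, ((univ.filter (G.Adj v)).card : ℝ) := by
  by_contra! hcon
  have hne : Nonempty V := by
    by_contra hemp
    rw [not_nonempty_iff] at hemp
    exact hG.1 ⟨⟨fun x => hemp.elim x, fun {x} => hemp.elim x⟩, fun x => hemp.elim x⟩
  have hn : (0 : ℝ) < Fintype.card V := by exact_mod_cast Fintype.card_pos
  have hkdeg := hG.le_degree hL
  set s : V → ℕ := fun v => (univ.filter (G.Adj v)).card - k with hs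
  have hsr : ∀ v, (s v : ℝ) = (univ.filter (G.Adj v)).card - k := fun v =>
    Nat.cast_sub (hkdeg v)
  have hk0 : (0 : ℝ) < k := by
    rcases Nat.eq_zero_or_pos k with h | h
    · subst h; norm_num at hηk
    · exact_mod_cast h
  set Om : ℝ := (1 / 2 - α) * k with hOm
  obtain ⟨W, hWne, hW⟩ := exists_induced_minDegree (G := G)
    (fun v => Om + α / 100 * k + 2600 * s v) (by
      have h1 : ∑ v, (Om + α / 100 * k + 2600 * (s v : ℝ)) =
          Fintype.card V * (Om + α / 100 * k) +
            2600 * ((∑ v, ((univ.filter (G.Adj v)).card : ℝ)) - Fintype.card V * k) := by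
        simp_rw [hsr]
        rw [sum_add_distrib, sum_const, ← mul_sum, sum_sub_distrib, sum_const, card_univ]
        simp only [nsmul_eq_mul]
      have h2 : (Fintype.card V : ℝ) * k ≤ ∑ v, ((univ.filter (G.Adj v)).card : ℝ) := by
        calc (Fintype.card V : ℝ) * k = ∑ v : V, (k : ℝ) := by simp
          _ ≤ _ := sum_le_sum fun v _ => by exact_mod_cast hkdeg v
      have h3 : (0 : ℝ) < Fintype.card V * k := by positivity
      -- The origin of 1350: with n vertices and total excess x, edge counting needs 5199x <
      -- 1.98αnk. Here x ≤ α²nk/1350 ≤ αnk/2700, and 5199/2700 < 1.98.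
      have h4 : α ^ 2 ≤ α / 2 := by nlinarith
      rw [h1, hOm]
      nlinarith [mul_le_mul_of_nonneg_right h4 h3.le, mul_pos hα h3])
  have hWs : ∀ v ∈ W, 2599 * (s v : ℝ) ≤ k := by
    intro v hv
    have h1 := hW v hv
    have h2 : ((W.filter (G.Adj v)).card : ℝ) ≤ (univ.filter (G.Adj v)).card := by
      exact_mod_cast card_le_card (filter_subset_filter _ (subset_univ W))
    have h3 := hsr v
    have h4 : 0 ≤ Om := mul_nonneg (by linarith) hk0.le
    linarith
  let U := {x // x ∈ W}
  have hUne : Nonempty U := hWne.coe_sort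
  obtain ⟨H, hH⟩ : ∃ H : SimpleGraph U, ∀ a b : U, H.Adj a b ↔ G.Adj a b :=
    ⟨G.comap Subtype.val, fun a b => Iff.rfl⟩
  let emb : U ↪ V := Function.Embedding.subtype _
  have hcardmap : ∀ (X : Finset U) (u : U), (X.filter (H.Adj u)).card =
      ((X.map emb).filter (G.Adj u)).card := by
    intro X u
    rw [filter_map, card_map]
    exact congrArg card (filter_congr fun x _ => hH u x)
  have hunivmap : (univ : Finset U).map emb = W := by
    ext x; simp [emb, U]
  have hdegH : ∀ u : U, (univ.filter (H.Adj u)).card = (W.filter (G.Adj u)).card := by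
    intro u
    rw [hcardmap, hunivmap]
  refine not_critical_of_nearly_degree_lists (H := H) (C := C) (fun u => s u) Om (α / 100) k
    (mul_nonneg (by linarith) hk0.le) (by positivity) (by linarith) hηk hk ?_ ?_ ?_ ?_
  · intro u
    rw [hdegH]
    exact hW u u.2
  · intro u
    rw [hdegH]
    have h2 : ((W.filter (G.Adj u)).card : ℝ) ≤ (univ.filter (G.Adj u)).card := by
      exact_mod_cast card_le_card (filter_subset_filter _ (subset_univ W))
    have h1 := hWs u u.2
    have h3 := hsr u
    linarith
  · intro T hT
    have h1 : G.IsClique ((T.map emb : Finset V) : Set V) := by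
      intro a ha b hb hab
      obtain ⟨a', ha', rfl⟩ := mem_map.1 (mem_coe.1 ha)
      obtain ⟨b', hb', rfl⟩ := mem_map.1 (mem_coe.1 hb)
      exact (hH _ _).1 (hT ha' hb' fun e => hab (congrArg emb e))
    have h2 := h1.card_le_cliqueNum
    rw [card_map] at h2
    have h3 : (T.card : ℝ) ≤ G.cliqueNum := by exact_mod_cast h2
    linarith
  · intro X hX
    obtain ⟨L', h1, h2⟩ := hG.exists_not_listColorableOn hL (X.map emb) (hX.map)
    refine ⟨fun u => L' u, fun u hu => ?_, ?_⟩
    · have h3 := h1 u (mem_map_of_mem emb hu)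
      have h4 := hkdeg u
      rw [hcardmap]
      simp only [hs]
      omega
    · rintro ⟨χ, hχL, hχ⟩
      obtain ⟨x0, hx0⟩ := hX
      refine h2 ⟨fun x => if h : x ∈ W then χ ⟨x, h⟩ else χ x0, ?_, ?_⟩
      · intro a ha
        obtain ⟨a', ha', rfl⟩ := mem_map.1 ha
        have : emb a' ∈ W := a'.2
        simp only [this, dif_pos]
        exact hχL a' ha'
      · intro a ha b hb hab
        obtain ⟨a', ha', rfl⟩ := mem_map.1 ha
        obtain ⟨b', hb', rfl⟩ := mem_map.1 hb
        have e1 : emb a' ∈ W := a'.2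
        have e2 : emb b' ∈ W := b'.2
        simp only [e1, e2, dif_pos]
        exact hχ a' ha' b' hb' ((hH _ _).2 hab)

end Reduction

end SimpleGraph

end

/-! ### Choice of the threshold and conclusion. -/

theorem eventually_pow_mul_exp_le {b : ℝ} (hb : 0 < b) :
    ∀ᶠ k : ℕ in Filter.atTop, 1024 * (k : ℝ) ^ 4 * Real.exp (-b * k) ≤ 1 := by
  have h := (tendsto_rpow_mul_exp_neg_mul_atTop_nhds_zero 4 b hb).comp
    (tendsto_natCast_atTop_atTop (R := ℝ))
  filter_upwards [h.eventually_le_const (show (0 : ℝ) < 1 / 1024 by norm_num)] with k hk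
  have e : ((k : ℝ) ^ (4 : ℝ)) = (k : ℝ) ^ 4 := by exact_mod_cast Real.rpow_natCast (k : ℝ) 4
  simp only [Function.comp_apply, e] at hk
  linarith

theorem mainTheorem2 :
    ∀ α : ℝ, 0 < α → ∀ ε : ℝ, ε ≤ α ^ 2 / 1350 →
      ∃ k₀ : ℕ, ∀ k : ℕ, k₀ ≤ k →
        ∀ (V : Type*) [Fintype V] (C : Type*) (G : SimpleGraph V) [DecidableRel G.Adj]
          (L : V → Set C),
          SimpleGraph.IsListAssignment k L →
          G.IsListCritical L →
          (G.cliqueNum : ℝ) < (1 / 2 - α) * (k : ℝ) →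
          (1 + ε) * (k : ℝ) < G.avgDegree := by
  intro α hα ε hε
  have hb : 0 < 6e-13 * (α / 100) ^ 3 := by positivity
  obtain ⟨k₀, hk₀⟩ := Filter.eventually_atTop.1 ((eventually_pow_mul_exp_le hb).and
    (Filter.eventually_ge_atTop ⌈1000 / (α / 100)⌉₊))
  refine ⟨k₀, fun k hk V _ C G _ L hL hG hω => ?_⟩
  obtain ⟨h1, h2⟩ := hk₀ k hk
  -- For α ≥ 1/2 the clique hypothesis would make the clique number negative.
  have hα2 : α < 1 / 2 := by
    by_contra! h
    have h3 : (0 : ℝ) ≤ G.cliqueNum := Nat.cast_nonneg _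
    have h4 : (1 / 2 - α) * (k : ℝ) ≤ 0 :=
      mul_nonpos_of_nonpos_of_nonneg (by linarith) (Nat.cast_nonneg _)
    linarith
  have hηk : 1000 ≤ α / 100 * k := by
    have h3 := (Nat.le_ceil (1000 / (α / 100))).trans (Nat.cast_le.2 h2)
    rw [div_le_iff₀ (by positivity)] at h3
    linarith
  have hsum := hG.lt_sum_degree_of_large hα hα2 hηk h1 hL hω
  have hdeg : ∀ v, ((Finset.univ.filter (G.Adj v)).card : ℝ) = (G.degree v : ℝ) := by
    intro v
    rw [← SimpleGraph.card_neighborFinset_eq_degree, SimpleGraph.neighborFinset_eq_filter]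
  have hn : (0 : ℝ) < Fintype.card V := by
    by_contra! h
    have h0 : Fintype.card V = 0 := by exact_mod_cast h.antisymm (Nat.cast_nonneg _)
    have := Fintype.card_eq_zero_iff.1 h0
    simp at hsum
  rw [SimpleGraph.avgDegree, lt_div_iff₀ hn]
  simp_rw [← hdeg]
  refine lt_of_le_of_lt ?_ (hsum.trans_eq ?_)
  · gcongr
  · congr!
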